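/- Let $n\ge 3$, let $(M,g)$ be a connected smooth $n$-dimensional pseudo-Riemannian manifold (without boundary, any signature), let $f\colon M\to(0,\infty)$ be smooth, and let $I\subseteq\mathbb R$ be a nonempty open interval. Let $\bar M=I_f\times M$ be the $(n+1)$-dimensional standard static space-time, i.e. $I\times M$ with the metric $\bar g=-f^2\,\mathrm dt^2\oplus g$, and let $\bar\tau$ be its scalar curvature. With the convention $\mathcal R(X,Y)Z=\nabla_Y\nabla_XZ-\nabla_X\nabla_YZ+\nabla_{[X,Y]}Z$, the concircular curvature tensor of an $N$-dimensional pseudo-Riemannian manifold with metric $g$ and scalar curvature $\tau$ is $$\mathcal C(X,Y)Z=\mathcal R(X,Y)Z-\frac{\tau}{N(N-1)}\,[\,g(X,Z)Y-g(Y,Z)X\,],$$ and the manifold is called concircularly flat if $\mathcal C$ vanishes at every point. Proposition. $\bar M$ is concircularly flat if and only if both of the following hold: 1. $\displaystyle \nabla_X\,\mathrm{grad} f=-\frac{\bar\tau f}{n(n+1)}\,X$ at every point of $\bar M$ and for every vector $X$ tangent to $M$, where $\nabla$ and $\mathrm{grad}$ are the Levi-Civita connection and the gradient of $(M,g)$;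 2. $\bar\tau$ is constant on $\bar M$, and $(M,g)$ has constant sectional curvature $\displaystyle \kappa=\frac{\bar\tau}{n(n+1)}$, i.e. every nondegenerate tangent plane of $M$ has sectional curvature $\kappa$. -/

import Mathlib

open Set Manifold
open scoped ContDiff Topology

set_option maxSynthPendingDepth 3

noncomputable section

namespace PseudoRiemannian

section Basic

variable {E : Type*} [NormedAddCommGroup E] [NormedSpace ℝ E]
  {H : Type*} [TopologicalSpace H] {I : ModelWithCorners ℝ E H}
  {M : Type*} [TopologicalSpace M] [ChartedSpace H M]

/-- Interchange of the first two arguments of a bilinear map, as a linear operation. -/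
def flipCLM (E F : Type*) [NormedAddCommGroup E] [NormedSpace ℝ E]
    [NormedAddCommGroup F] [NormedSpace ℝ F] :
    (E →L[ℝ] E →L[ℝ] F) →L[ℝ] (E →L[ℝ] E →L[ℝ] F) :=
  (ContinuousLinearMap.flipₗᵢ ℝ E E F).toContinuousLinearEquiv

theorem flipCLM_apply {E F : Type*} [NormedAddCommGroup E] [NormedSpace ℝ E]
    [NormedAddCommGroup F] [NormedSpace ℝ F] (A : E →L[ℝ] E →L[ℝ] F) (u v : E) :
    flipCLM E F A u v = A v u := rfl

/-- The expression of a covariant 2-tensor field `g` in the preferred chart `φ` at `x₀`: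
`(u, v) ↦ g (dφ⁻¹ u, dφ⁻¹ v)` at the point `φ⁻¹ y`. In a basis of `E` its components are the
usual `g_ij`. -/
def tensorInChart (I : ModelWithCorners ℝ E H)
    (g : ∀ x : M, TangentSpace I x →L[ℝ] TangentSpace I x →L[ℝ] ℝ) (x₀ : M) (y : E) :
    E →L[ℝ] E →L[ℝ] ℝ :=
  ContinuousLinearMap.bilinearComp (E := E) (F := E) (E' := E) (F' := E)
    (g ((extChartAt I x₀).symm y))
    (mfderiv 𝓘(ℝ, E) I (extChartAt I x₀).symm y)
    (mfderiv 𝓘(ℝ, E) I (extChartAt I x₀).symm y)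

/-- A smooth pseudo-Riemannian metric on a manifold without boundary: a symmetric nondegenerate
2-tensor field, of any signature, whose components in charts are smooth. -/
structure Metric (I : ModelWithCorners ℝ E H) [I.Boundaryless]
    (M : Type*) [TopologicalSpace M] [ChartedSpace H M] where
  /-- the scalar product on each tangent space -/
  val : ∀ x : M, TangentSpace I x →L[ℝ] TangentSpace I x →L[ℝ] ℝ
  symm : ∀ (x : M) (v w : TangentSpace I x), val x v w = val x w v
  nondegenerate : ∀ (x : M) (v : TangentSpace I x), (∀ w, val x v w = 0) → v = 0
  smooth : ∀ x₀ : M, ContDiffOn ℝ ∞ (tensorInChart I val x₀) (extChartAt I x₀).target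

variable [I.Boundaryless] (g : Metric I M)

/-- The metric in the preferred chart at `x₀`, as a function of the coordinate point `y`. -/
def Metric.inChart (x₀ : M) : E → (E →L[ℝ] E →L[ℝ] ℝ) := tensorInChart I g.val x₀

/-- The Christoffel symbols of the first kind of the Levi-Civita connection in the preferred chart
at `x₀`, see `christoffelFirst_apply`. -/
def Metric.christoffelFirst (x₀ : M) (y : E) : E →L[ℝ] E →L[ℝ] E →L[ℝ] ℝ :=
  (1 / 2 : ℝ) • (fderiv ℝ (g.inChart x₀) y + (fderiv ℝ (g.inChart x₀) y).flip
    - flipCLM E ℝ ∘L (fderiv ℝ (g.inChart x₀) y).flip)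

theorem Metric.christoffelFirst_apply (x₀ : M) (y u v w : E) :
    g.christoffelFirst x₀ y u v w =
      1 / 2 * (fderiv ℝ (g.inChart x₀) y u v w + fderiv ℝ (g.inChart x₀) y v u w
        - fderiv ℝ (g.inChart x₀) y w u v) := rfl

/-- The Christoffel symbols of the Levi-Civita connection in the preferred chart at `x₀`:
`Γ(u, v)` is the vector obtained from the covector `Γ₁(u, v, ·)` by raising the index. -/
def Metric.christoffel (x₀ : M) (y : E) : E →L[ℝ] E →L[ℝ] E :=
  (ContinuousLinearMap.compL ℝ E (E →L[ℝ] ℝ) E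
    (ContinuousLinearMap.inverse (g.inChart x₀ y))) ∘L g.christoffelFirst x₀ y

theorem Metric.christoffel_apply (x₀ : M) (y u v : E) :
    g.christoffel x₀ y u v =
      ContinuousLinearMap.inverse (g.inChart x₀ y) (g.christoffelFirst x₀ y u v) := rfl

/-- The quadratic term `(u, v, w) ↦ Γ(u, Γ(v, w))` of the curvature. -/
def Metric.christoffelSq (x₀ : M) (y : E) : E →L[ℝ] E →L[ℝ] E →L[ℝ] E :=
  ((ContinuousLinearMap.compL ℝ E (E →L[ℝ] E) (E →L[ℝ] E)).flip (g.christoffel x₀ y))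
    ∘L (ContinuousLinearMap.compL ℝ E E E) ∘L (g.christoffel x₀ y)

theorem Metric.christoffelSq_apply (x₀ : M) (y u v w : E) :
    g.christoffelSq x₀ y u v w = g.christoffel x₀ y u (g.christoffel x₀ y v w) := rfl

/-- The curvature tensor in the preferred chart at `x₀`, see `curvatureInChart_apply`. -/
def Metric.curvatureInChart (x₀ : M) (y : E) : E →L[ℝ] E →L[ℝ] E →L[ℝ] E :=
  (fderiv ℝ (g.christoffel x₀) y).flip - fderiv ℝ (g.christoffel x₀) y
    + (g.christoffelSq x₀ y).flip - g.christoffelSq x₀ y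

theorem Metric.curvatureInChart_apply (x₀ : M) (y u v w : E) :
    g.curvatureInChart x₀ y u v w =
      fderiv ℝ (g.christoffel x₀) y v u w - fderiv ℝ (g.christoffel x₀) y u v w
        + g.christoffel x₀ y v (g.christoffel x₀ y u w)
        - g.christoffel x₀ y u (g.christoffel x₀ y v w) := rfl

/-- The Riemann curvature tensor
`R(X, Y) Z = ∇_Y ∇_X Z - ∇_X ∇_Y Z + ∇_[X, Y] Z` at `x`. The tangent space at `x` is identified
with `E` by the preferred chart at `x`, so the tensor is read off in that chart. -/
def Metric.curvature (x : M) :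
    TangentSpace I x →L[ℝ] TangentSpace I x →L[ℝ] TangentSpace I x →L[ℝ] TangentSpace I x :=
  g.curvatureInChart x (extChartAt I x x)

variable [FiniteDimensional ℝ E]

/-- The trace of an endomorphism, as a continuous linear functional. -/
def traceCLM (F : Type*) [NormedAddCommGroup F] [NormedSpace ℝ F] [FiniteDimensional ℝ F] :
    (F →L[ℝ] F) →L[ℝ] ℝ :=
  LinearMap.toContinuousLinearMap (LinearMap.trace ℝ F ∘ₗ ContinuousLinearMap.coeLM ℝ)

/-- The Ricci tensor `Ric(X, Y) = trace (V ↦ R(X, V) Y)`, see `ricci_apply`. -/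
def Metric.ricci (x : M) : TangentSpace I x →L[ℝ] TangentSpace I x →L[ℝ] ℝ :=
  (ContinuousLinearMap.compL ℝ E (E →L[ℝ] E) ℝ (traceCLM E))
    ∘L flipCLM E E ∘L (g.curvature x : E →L[ℝ] E →L[ℝ] E →L[ℝ] E)

theorem Metric.ricci_apply (x : M) (u v : TangentSpace I x) :
    g.ricci x u v =
      LinearMap.trace ℝ E (flipCLM E E (g.curvature x u) v : E →L[ℝ] E) := rfl

/-- Raising an index: the tangent vector `v` at `x` with `g (v, ·) = α`. -/
def Metric.sharp (x : M) : (TangentSpace I x →L[ℝ] ℝ) →L[ℝ] TangentSpace I x :=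
  ContinuousLinearMap.inverse (g.val x)

/-- The scalar curvature, the trace `g^ij R_ij` of the Ricci tensor with respect to `g`. -/
def Metric.scalarCurvature (x : M) : ℝ := traceCLM E (g.sharp x ∘L g.ricci x)

/-- The gradient of a function, the vector field with `g (grad f, ·) = df`. -/
def Metric.grad (f : M → ℝ) (x : M) : TangentSpace I x :=
  g.sharp x (mfderiv I 𝓘(ℝ, ℝ) f x)

/-- The components of a vector field in the preferred chart `φ` at `x₀`: the vector `dφ (V)` at
the point `φ⁻¹ y`. -/
def vectorFieldInChart (V : ∀ x : M, TangentSpace I x) (x₀ : M) (y : E) : E :=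
  mfderiv I 𝓘(ℝ, E) (extChartAt I x₀) ((extChartAt I x₀).symm y) (V ((extChartAt I x₀).symm y))

/-- The Levi-Civita covariant derivative `∇_X V` at `x` of a vector field `V` in the direction of
the tangent vector `X`, given in the preferred chart at `x` by `D_X V + Γ(X, V)`. -/
def Metric.covDeriv (V : ∀ x : M, TangentSpace I x) (x : M) (X : TangentSpace I x) :
    TangentSpace I x :=
  (fderiv ℝ (vectorFieldInChart V x) (extChartAt I x x) X
    + g.christoffel x (extChartAt I x x) X (V x) : E)

/-- `g (u, u) g (v, v) - g (u, v) ^ 2`; it is nonzero exactly if `u, v` span a nondegenerate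
plane. -/
def Metric.areaSq (x : M) (u v : TangentSpace I x) : ℝ :=
  g.val x u u * g.val x v v - g.val x u v ^ 2

/-- The sectional curvature of the plane spanned by `u` and `v`. -/
def Metric.sectionalCurvature (x : M) (u v : TangentSpace I x) : ℝ :=
  g.val x (g.curvature x u v u) v / g.areaSq x u v

/-- Every nondegenerate tangent plane has sectional curvature `κ`. -/
def Metric.HasConstantSectionalCurvature (κ : ℝ) : Prop :=
  ∀ (x : M) (u v : TangentSpace I x), g.areaSq x u v ≠ 0 → g.sectionalCurvature x u v = κ

/-- The concircular curvature tensor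
`C(X, Y) Z = R(X, Y) Z - τ / (N (N - 1)) (g(X, Z) Y - g(Y, Z) X)`, where `τ` is the scalar
curvature and `N` the dimension of the manifold. -/
def Metric.concircular (x : M) (X Y Z : TangentSpace I x) : TangentSpace I x :=
  g.curvature x X Y Z
    - (g.scalarCurvature x / ((Module.finrank ℝ E : ℝ) * ((Module.finrank ℝ E : ℝ) - 1))) •
      (g.val x X Z • Y - g.val x Y Z • X)

/-- The concircular curvature tensor vanishes at every point. -/
def Metric.ConcircularlyFlat : Prop :=
  ∀ (x : M) (X Y Z : TangentSpace I x), g.concircular x X Y Z = 0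

end Basic

section Static

variable {E : Type*} [NormedAddCommGroup E] [NormedSpace ℝ E]
  {M : Type*} [TopologicalSpace M] [ChartedSpace E M]

/-- The 1-form `dt` on `J × M`, for an open set `J` of real numbers. -/
def dt (J : TopologicalSpace.Opens ℝ) (p : J × M) :
    TangentSpace (𝓘(ℝ, ℝ).prod 𝓘(ℝ, E)) p →L[ℝ] ℝ :=
  mfderiv (𝓘(ℝ, ℝ).prod 𝓘(ℝ, E)) 𝓘(ℝ, ℝ) (fun q : J × M => (q.1 : ℝ)) p

/-- The differential of the projection `J × M → M`. -/
def dproj (J : TopologicalSpace.Opens ℝ) (p : J × M) :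
    TangentSpace (𝓘(ℝ, ℝ).prod 𝓘(ℝ, E)) p →L[ℝ] TangentSpace 𝓘(ℝ, E) p.2 :=
  mfderiv (𝓘(ℝ, ℝ).prod 𝓘(ℝ, E)) 𝓘(ℝ, E) (fun q : J × M => q.2) p

/-- The 2-tensor field `-f² dt² ⊕ g` on `J × M`. -/
def staticTensor (J : TopologicalSpace.Opens ℝ) (f : M → ℝ) (g : Metric 𝓘(ℝ, E) M) (p : J × M) :
    TangentSpace (𝓘(ℝ, ℝ).prod 𝓘(ℝ, E)) p →L[ℝ] TangentSpace (𝓘(ℝ, ℝ).prod 𝓘(ℝ, E)) p →L[ℝ] ℝ :=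
  let α : ℝ × E →L[ℝ] ℝ := dt J p
  let β : ℝ × E →L[ℝ] ℝ × E →L[ℝ] ℝ :=
    ContinuousLinearMap.bilinearComp (E := E) (F := E) (E' := ℝ × E) (F' := ℝ × E)
      (g.val p.2) (dproj J p) (dproj J p)
  (-(f p.2 ^ 2) • α.smulRight α + β : ℝ × E →L[ℝ] ℝ × E →L[ℝ] ℝ)

theorem extChartAt_opens (J : TopologicalSpace.Opens ℝ) (t s : J) :
    extChartAt 𝓘(ℝ, ℝ) t s = (s : ℝ) := rfl

theorem extChartAt_opens_symm (J : TopologicalSpace.Opens ℝ) (t : J) (r : ℝ)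
    (hr : r ∈ (extChartAt 𝓘(ℝ, ℝ) t).target) :
    (((extChartAt 𝓘(ℝ, ℝ) t).symm r : J) : ℝ) = r := by
  rw [← extChartAt_opens J t, (extChartAt 𝓘(ℝ, ℝ) t).right_inv hr]

theorem hasMFDerivAt_opens_val (J : TopologicalSpace.Opens ℝ) (t : J) :
    HasMFDerivAt 𝓘(ℝ, ℝ) 𝓘(ℝ, ℝ) (fun s : J => (s : ℝ)) t (ContinuousLinearMap.id ℝ ℝ) := by
  refine ⟨continuous_subtype_val.continuousAt, ?_⟩
  refine (hasFDerivWithinAt_id (𝕜 := ℝ) _ _).congr_of_eventuallyEq ?_ ?_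
  · filter_upwards [extChartAt_target_mem_nhdsWithin (I := 𝓘(ℝ, ℝ)) t] with r hr
    exact extChartAt_opens_symm J t r hr
  · exact extChartAt_opens_symm J t _ (mem_extChartAt_target t)

theorem dt_apply (J : TopologicalSpace.Opens ℝ) (p : J × M)
    (v : TangentSpace (𝓘(ℝ, ℝ).prod 𝓘(ℝ, E)) p) : dt J p v = (v : ℝ × E).1 := by
  have h := (hasMFDerivAt_opens_val J p.1).comp p
    (hasMFDerivAt_fst (I := 𝓘(ℝ, ℝ)) (I' := 𝓘(ℝ, E)) p)
  unfold dt
  rw [HasMFDerivAt.mfderiv (f := fun q : J × M => (q.1 : ℝ)) h]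
  rfl

theorem dproj_apply (J : TopologicalSpace.Opens ℝ) (p : J × M)
    (v : TangentSpace (𝓘(ℝ, ℝ).prod 𝓘(ℝ, E)) p) : dproj J p v = (v : ℝ × E).2 := by
  simp only [dproj]
  rw [mfderiv_snd]; rfl

theorem staticTensor_apply (J : TopologicalSpace.Opens ℝ) (f : M → ℝ) (g : Metric 𝓘(ℝ, E) M)
    (p : J × M) (v w : TangentSpace (𝓘(ℝ, ℝ).prod 𝓘(ℝ, E)) p) :
    staticTensor J f g p v w =
      -(f p.2 ^ 2) * (dt J p v * dt J p w) + g.val p.2 (dproj J p v) (dproj J p w) := by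
  rfl

theorem staticTensor_inChart [IsManifold 𝓘(ℝ, E) ∞ M]
    (J : TopologicalSpace.Opens ℝ) (f : M → ℝ) (g : Metric 𝓘(ℝ, E) M) (p : J × M)
    (y : ℝ × E) (hy : y ∈ (extChartAt (𝓘(ℝ, ℝ).prod 𝓘(ℝ, E)) p).target) (v w : ℝ × E) :
    tensorInChart (𝓘(ℝ, ℝ).prod 𝓘(ℝ, E)) (staticTensor J f g) p y v w =
      -(f ((extChartAt 𝓘(ℝ, E) p.2).symm y.2) ^ 2) * (v.1 * w.1)
        + g.inChart p.2 y.2 v.2 w.2 := by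
  set e := extChartAt (𝓘(ℝ, ℝ).prod 𝓘(ℝ, E)) p with he
  have hopen : e.target ∈ 𝓝 y := (isOpen_extChartAt_target p).mem_nhds hy
  have hd : MDifferentiableAt 𝓘(ℝ, ℝ × E) (𝓘(ℝ, ℝ).prod 𝓘(ℝ, E)) e.symm y :=
    ((contMDiffOn_extChartAt_symm (n := ∞) p).contMDiffAt hopen).mdifferentiableAt (by simp)
  have htgt : ∀ z ∈ e.target, z.1 ∈ (extChartAt 𝓘(ℝ, ℝ) p.1).target ∧
      z.2 ∈ (extChartAt 𝓘(ℝ, E) p.2).target := by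
    intro z hz
    rw [he, extChartAt_prod] at hz
    exact hz
  have hd2 : MDifferentiableAt 𝓘(ℝ, E) 𝓘(ℝ, E) (extChartAt 𝓘(ℝ, E) p.2).symm y.2 :=
    ((contMDiffOn_extChartAt_symm (n := ∞) p.2).contMDiffAt
      ((isOpen_extChartAt_target p.2).mem_nhds (htgt y hy).2)).mdifferentiableAt (by simp)
  have h1 : ∀ u : ℝ × E, dt J (e.symm y)
      (mfderiv 𝓘(ℝ, ℝ × E) (𝓘(ℝ, ℝ).prod 𝓘(ℝ, E)) e.symm y u) = u.1 := by
    intro u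
    have hv : MDifferentiableAt (𝓘(ℝ, ℝ).prod 𝓘(ℝ, E)) 𝓘(ℝ, ℝ)
        (fun q : J × M => (q.1 : ℝ)) (e.symm y) :=
      ((hasMFDerivAt_opens_val J (e.symm y).1).comp (e.symm y)
        (hasMFDerivAt_fst (I := 𝓘(ℝ, ℝ)) (I' := 𝓘(ℝ, E)) (e.symm y))).mdifferentiableAt
    have hc := mfderiv_comp_apply y hv hd u
    refine hc.symm.trans ?_
    have hev : ((fun q : J × M => (q.1 : ℝ)) ∘ e.symm) =ᶠ[𝓝 y] Prod.fst := by
      filter_upwards [hopen] with z hz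
      exact extChartAt_opens_symm J p.1 z.1 (htgt z hz).1
    rw [hev.mfderiv_eq, mfderiv_eq_fderiv, fderiv_fst]
    rfl
  have h2 : ∀ u : ℝ × E, dproj J (e.symm y)
      (mfderiv 𝓘(ℝ, ℝ × E) (𝓘(ℝ, ℝ).prod 𝓘(ℝ, E)) e.symm y u) =
        mfderiv 𝓘(ℝ, E) 𝓘(ℝ, E) (extChartAt 𝓘(ℝ, E) p.2).symm y.2 u.2 := by
    intro u
    have hc := mfderiv_comp_apply y
      (mdifferentiableAt_snd (I := 𝓘(ℝ, ℝ)) (I' := 𝓘(ℝ, E)) (x := e.symm y)) hd u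
    refine hc.symm.trans ?_
    have hev : (Prod.snd ∘ e.symm : ℝ × E → M) = (extChartAt 𝓘(ℝ, E) p.2).symm ∘ Prod.snd := by
      rw [he, extChartAt_prod]
      rfl
    rw [hev]
    have hs : HasMFDerivAt 𝓘(ℝ, ℝ × E) 𝓘(ℝ, E) (Prod.snd : ℝ × E → E) y
        (ContinuousLinearMap.snd ℝ ℝ E) := hasFDerivAt_snd.hasMFDerivAt
    have hcc := hd2.hasMFDerivAt.comp y hs
    rw [hcc.mfderiv]
    rfl
  change staticTensor J f g (e.symm y) (mfderiv 𝓘(ℝ, ℝ × E) (𝓘(ℝ, ℝ).prod 𝓘(ℝ, E)) e.symm y v)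
    (mfderiv 𝓘(ℝ, ℝ × E) (𝓘(ℝ, ℝ).prod 𝓘(ℝ, E)) e.symm y w) = _
  rw [staticTensor_apply, h1, h1, h2, h2]
  rfl

/-- The standard static space-time: `J × M` with the metric `-f² dt² ⊕ g`. -/
def staticMetric [IsManifold 𝓘(ℝ, E) ∞ M] (J : TopologicalSpace.Opens ℝ) (f : M → ℝ)
    (hf : ContMDiff 𝓘(ℝ, E) 𝓘(ℝ, ℝ) ∞ f) (hpos : ∀ x, 0 < f x) (g : Metric 𝓘(ℝ, E) M) :
    Metric (𝓘(ℝ, ℝ).prod 𝓘(ℝ, E)) (J × M) where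
  val := staticTensor J f g
  symm p v w := by
    rw [staticTensor_apply, staticTensor_apply, g.symm, mul_comm (dt J p v)]
  nondegenerate p v hv := by
    have hz : ∀ (a : ℝ) (w : TangentSpace 𝓘(ℝ, E) p.2), -(f p.2 ^ 2) * ((v : ℝ × E).1 * a)
        + g.val p.2 ((v : ℝ × E).2 : E) w = 0 := by
      intro a w
      let u : TangentSpace (𝓘(ℝ, ℝ).prod 𝓘(ℝ, E)) p := ((a, w) : ℝ × E)
      have h := staticTensor_apply J f g p v u
      rw [hv u, dt_apply, dt_apply, dproj_apply, dproj_apply] at h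
      exact h.symm
    have h2 : ((v : ℝ × E).2 : E) = 0 :=
      g.nondegenerate p.2 _ fun w => by simpa using hz 0 w
    have h1 : (v : ℝ × E).1 = 0 := by
      have h0 : g.val p.2 ((v : ℝ × E).2 : E) (0 : E) = 0 :=
        ContinuousLinearMap.map_zero (g.val p.2 ((v : ℝ × E).2 : E))
      have h : -(f p.2 ^ 2) * ((v : ℝ × E).1 * 1) = 0 :=
        (add_zero _).symm.trans ((congrArg (_ + ·) h0.symm).trans (hz 1 (0 : E)))
      rw [mul_one] at h
      exact (mul_eq_zero.mp h).resolve_left (neg_ne_zero.mpr (pow_ne_zero 2 (hpos p.2).ne'))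
    exact Prod.ext h1 h2
  smooth p := by
    set e := extChartAt (𝓘(ℝ, ℝ).prod 𝓘(ℝ, E)) p with he
    have htgt : MapsTo Prod.snd e.target (extChartAt 𝓘(ℝ, E) p.2).target := by
      intro z hz
      rw [he, extChartAt_prod] at hz
      exact hz.2
    have hfs : ContDiffOn ℝ ∞ (fun y : ℝ × E => f ((extChartAt 𝓘(ℝ, E) p.2).symm y.2))
        e.target := by
      have h0 : ContDiffOn ℝ ∞ (f ∘ (extChartAt 𝓘(ℝ, E) p.2).symm)
          (extChartAt 𝓘(ℝ, E) p.2).target :=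
        (hf.comp_contMDiffOn (contMDiffOn_extChartAt_symm (n := ∞) p.2)).contDiffOn
      exact h0.comp contDiffOn_snd htgt
    have hgs : ContDiffOn ℝ ∞ (fun y : ℝ × E => g.inChart p.2 y.2) e.target :=
      (g.smooth p.2).comp contDiffOn_snd htgt
    let τ : ℝ × E →L[ℝ] ℝ := ContinuousLinearMap.fst ℝ ℝ E
    let π : ℝ × E →L[ℝ] E := ContinuousLinearMap.snd ℝ ℝ E
    have hG : ContDiffOn ℝ ∞ (fun y : ℝ × E =>
        -(f ((extChartAt 𝓘(ℝ, E) p.2).symm y.2) ^ 2) • τ.smulRight τ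
          + (((ContinuousLinearMap.compL ℝ (ℝ × E) E ℝ).flip π) ∘L
              ((g.inChart p.2 y.2) ∘L π))) e.target :=
      ((hfs.pow 2).neg.smul contDiffOn_const).add
        (contDiffOn_const.clm_comp (hgs.clm_comp contDiffOn_const))
    refine hG.congr fun y hy => ?_
    refine ContinuousLinearMap.ext fun v => ContinuousLinearMap.ext fun w => ?_
    exact staticTensor_inChart J f g p y hy v w

end Static

end PseudoRiemannian

end

set_option linter.unusedSectionVars false

/-! In a product chart the curvature of `-f² dt² ⊕ g` is the curvature of `g` plus terms in the
Hessian of `f` (`staticMetric_curvatureInChart`). Put k = τ̄ / (n(n+1)). Concircular flatness tested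
on (∂t, X, ∂t) says ∇_X grad f = -k f X; tested on vectors tangent to M it says R(X, Y)Z = k (g(X,
Z)Y - g(Y, Z)X). These two equations imply all the others (`staticMetric_concircularlyFlat_iff`),
and no formula for τ̄ in terms of g and f is needed.

It remains to see that k is constant. It does not depend on t, since f > 0 and ∇ grad f lives on M.
On M, the Ricci identity gives R(X, Y) grad f = d(-kf)(Y) X - d(-kf)(X) Y. Comparison with the
second equation cancels the terms in df and leaves f (dk(X)Y - dk(Y)X) = 0, so dk = 0 by
independence of X and Y (`Metric.hasMFDerivAt_zero_of_covDeriv_grad`), and connectedness finishes.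

The second equation amounts to constant sectional curvature in any signature
(`curvature_eq_of_sectional`): degenerate planes are limits of nondegenerate ones, and a
curvature-like tensor that vanishes on all (u, v, u, v) is zero.

Curvature and covariant derivative are read at each point in the chart preferred at that point.
Differentiating an identity along M therefore requires the transformation law of the Christoffel
symbols. -/

namespace PseudoRiemannian

open ContinuousLinearMap

/-! ### Levi-Civita connection and symmetries of the curvature in one chart -/

section Chart

variable {E : Type*} [NormedAddCommGroup E] [NormedSpace ℝ E]
  {H : Type*} [TopologicalSpace H] {I : ModelWithCorners ℝ E H}
  {M : Type*} [TopologicalSpace M] [ChartedSpace H M]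

/-- Equality of base points allows to compare values of a tensor field. -/
theorem tensor_congr (T : ∀ x : M, TangentSpace I x →L[ℝ] TangentSpace I x →L[ℝ] ℝ) {x x' : M}
    (h : x = x') {u v u' v' : E} (hu : u = u') (hv : v = v') :
    T x u v = T x' u' v' := by
  subst h hu hv; rfl

variable [I.Boundaryless]

theorem mfderiv_extChartAt_symm_injective [IsManifold I ∞ M] {x₀ : M} {y : E}
    (hy : y ∈ (extChartAt I x₀).target) {v : E}
    (hv : (mfderiv 𝓘(ℝ, E) I (extChartAt I x₀).symm y v : E) = 0) : v = 0 := by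
  have : IsManifold I 1 M := IsManifold.of_le (n := ∞) (by simp)
  have h := mfderiv_extChartAt_comp_mfderivWithin_extChartAt_symm (I := I) hy
  rw [I.range_eq_univ, mfderivWithin_univ] at h
  have h1 := congrArg (fun A => A v) h
  have h2 : mfderiv I 𝓘(ℝ, E) (extChartAt I x₀) ((extChartAt I x₀).symm y)
      (mfderiv 𝓘(ℝ, E) I (extChartAt I x₀).symm y v) = v := h1
  rw [← h2]
  let A : E →L[ℝ] E := mfderiv I 𝓘(ℝ, E) (extChartAt I x₀) ((extChartAt I x₀).symm y)
  exact (congrArg A hv).trans A.map_zero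

theorem mfderiv_extChartAt_symm_apply [IsManifold I ∞ M] {x₀ : M} {y : E}
    (hy : y ∈ (extChartAt I x₀).target) (v : TangentSpace I ((extChartAt I x₀).symm y)) :
    mfderiv 𝓘(ℝ, E) I (extChartAt I x₀).symm y
      (mfderiv I 𝓘(ℝ, E) (extChartAt I x₀) ((extChartAt I x₀).symm y) v) = v := by
  have : IsManifold I 1 M := IsManifold.of_le (n := ∞) (by simp)
  have h := mfderivWithin_extChartAt_symm_comp_mfderiv_extChartAt (I := I) hy
  rw [I.range_eq_univ, mfderivWithin_univ] at h
  exact congrArg (fun A => A v) h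

/-- The manifold derivative at `x` is computed in the preferred chart at `x`, and there that chart
reads as the identity. -/
theorem mfderiv_extChartAt_self [IsManifold I ∞ M] (x : M) (v : E) :
    (mfderiv I 𝓘(ℝ, E) (extChartAt I x) x v : E) = v := by
  have : IsManifold I 1 M := IsManifold.of_le (n := ∞) (by simp)
  have hd : MDifferentiableAt I 𝓘(ℝ, E) (extChartAt I x) x :=
    mdifferentiableAt_extChartAt (mem_chart_source H x)
  have h : HasMFDerivAt I 𝓘(ℝ, E) (extChartAt I x) x (ContinuousLinearMap.id ℝ E) := by
    refine ⟨hd.continuousAt, ?_⟩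
    refine (hasFDerivWithinAt_id (𝕜 := ℝ) _ _).congr_of_eventuallyEq ?_ ?_
    · filter_upwards [extChartAt_target_mem_nhdsWithin (I := I) x] with z hz
      exact (extChartAt I x).right_inv hz
    · exact (extChartAt I x).right_inv (mem_extChartAt_target x)
  exact congrArg (fun A : E →L[ℝ] E => A v) h.mfderiv

theorem mfderiv_extChartAt_symm_self [IsManifold I ∞ M] (x : M) (v : E) :
    (mfderiv 𝓘(ℝ, E) I (extChartAt I x).symm (extChartAt I x x) v : E) = v := by
  have : IsManifold I 1 M := IsManifold.of_le (n := ∞) (by simp)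
  have h := mfderivWithin_extChartAt_symm_comp_mfderiv_extChartAt' (I := I)
    (mem_extChartAt_source (I := I) x)
  rw [I.range_eq_univ, mfderivWithin_univ] at h
  have h1 : (mfderiv 𝓘(ℝ, E) I (extChartAt I x).symm (extChartAt I x x)
    (mfderiv I 𝓘(ℝ, E) (extChartAt I x) x v) : E) = v := congrArg (fun A => A v) h
  have h2 := mfderiv_extChartAt_self (I := I) x v
  exact (congrArg (fun w : E =>
    (mfderiv 𝓘(ℝ, E) I (extChartAt I x).symm (extChartAt I x x) w : E)) h2).symm.trans h1

variable (g : Metric I M)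

theorem Metric.inChart_eq (x₀ : M) (y u v : E) :
    g.inChart x₀ y u v = g.val ((extChartAt I x₀).symm y)
      (mfderiv 𝓘(ℝ, E) I (extChartAt I x₀).symm y u)
      (mfderiv 𝓘(ℝ, E) I (extChartAt I x₀).symm y v) := rfl

theorem Metric.inChart_symm (x₀ : M) (y u v : E) : g.inChart x₀ y u v = g.inChart x₀ y v u :=
  (g.inChart_eq x₀ y u v).trans ((g.symm _ _ _).trans (g.inChart_eq x₀ y v u).symm)

theorem Metric.inChart_self [IsManifold I ∞ M] (x : M) (u v : E) :
    g.inChart x (extChartAt I x x) u v = g.val x u v :=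
  (g.inChart_eq x (extChartAt I x x) u v).trans
    (tensor_congr g.val (extChartAt_to_inv (I := I) x) (mfderiv_extChartAt_symm_self (I := I) x u)
      (mfderiv_extChartAt_symm_self (I := I) x v))

theorem Metric.contDiffAt_inChart {x₀ : M} {y : E} (hy : y ∈ (extChartAt I x₀).target) :
    ContDiffAt ℝ ∞ (g.inChart x₀) y :=
  (g.smooth x₀).contDiffAt ((isOpen_extChartAt_target x₀).mem_nhds hy)

theorem Metric.inChart_nondegenerate [IsManifold I ∞ M] {x₀ : M} {y : E}
    (hy : y ∈ (extChartAt I x₀).target) {v : E} (hv : ∀ w, g.inChart x₀ y v w = 0) : v = 0 := by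
  refine mfderiv_extChartAt_symm_injective hy (g.nondegenerate _ _ fun w => ?_)
  rw [← mfderiv_extChartAt_symm_apply hy w]
  exact hv _

/-- Injectivity suffices because `E` and its dual have equal dimension. `inverse` takes the value
zero on non-invertible maps, so this is what makes index raising genuine. -/
theorem isInvertible_of_nondegenerate {E : Type*} [NormedAddCommGroup E] [NormedSpace ℝ E]
    [FiniteDimensional ℝ E] (B : E →L[ℝ] E →L[ℝ] ℝ) (hB : ∀ v, (∀ w, B v w = 0) → v = 0) :
    B.IsInvertible := by
  have hinj : Function.Injective (B : E →ₗ[ℝ] E →L[ℝ] ℝ) := by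
    refine (injective_iff_map_eq_zero _).2 fun v hv => hB v fun w => ?_
    have : B v = 0 := hv
    simp [this]
  have hfr : Module.finrank ℝ E = Module.finrank ℝ (E →L[ℝ] ℝ) := by
    rw [← (LinearMap.toContinuousLinearMap (𝕜 := ℝ) (E := E) (F' := ℝ)).finrank_eq]
    exact (Subspace.dual_finrank_eq (K := ℝ) (V := E)).symm
  refine ⟨(LinearMap.linearEquivOfInjective _ hinj hfr).toContinuousLinearEquiv, ?_⟩
  ext v w
  rfl

variable [FiniteDimensional ℝ E] [IsManifold I ∞ M]

theorem Metric.isInvertible_inChart {x₀ : M} {y : E} (hy : y ∈ (extChartAt I x₀).target) :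
    (g.inChart x₀ y).IsInvertible :=
  isInvertible_of_nondegenerate _ fun _ hv => g.inChart_nondegenerate hy hv

theorem Metric.isInvertible_val (x : M) : (g.val x : E →L[ℝ] E →L[ℝ] ℝ).IsInvertible :=
  isInvertible_of_nondegenerate (E := E) (g.val x) fun v hv => g.nondegenerate x v hv

theorem Metric.eq_of_inChart_eq {x₀ : M} {y : E} (hy : y ∈ (extChartAt I x₀).target) {v v' : E}
    (h : ∀ w, g.inChart x₀ y v w = g.inChart x₀ y v' w) : v = v' :=
  sub_eq_zero.1 (g.inChart_nondegenerate hy fun w => by simp [h w])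

theorem Metric.inChart_inverse {x₀ : M} {y : E} (hy : y ∈ (extChartAt I x₀).target)
    (α : E →L[ℝ] ℝ) : g.inChart x₀ y (inverse (g.inChart x₀ y) α) = α :=
  (g.isInvertible_inChart hy).self_apply_inverse α

theorem Metric.contDiffAt_inverse_inChart {x₀ : M} {y : E}
    (hy : y ∈ (extChartAt I x₀).target) :
    ContDiffAt ℝ ∞ (fun z => inverse (g.inChart x₀ z)) y := by
  have := FiniteDimensional.complete ℝ E
  exact (g.isInvertible_inChart hy).contDiffAt_map_inverse.comp y (g.contDiffAt_inChart hy)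

theorem Metric.inChart_christoffel {x₀ : M} {y : E} (hy : y ∈ (extChartAt I x₀).target)
    (u v w : E) :
    g.inChart x₀ y (g.christoffel x₀ y u v) w =
      1 / 2 * (fderiv ℝ (g.inChart x₀) y u v w + fderiv ℝ (g.inChart x₀) y v u w
        - fderiv ℝ (g.inChart x₀) y w u v) := by
  rw [g.christoffel_apply, g.inChart_inverse hy, g.christoffelFirst_apply]

theorem Metric.fderiv_inChart_apply {x₀ : M} {y : E} (hy : y ∈ (extChartAt I x₀).target)
    (a u v : E) :
    fderiv ℝ (fun z => g.inChart x₀ z u v) y a = fderiv ℝ (g.inChart x₀) y a u v := by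
  have h := ((g.contDiffAt_inChart hy).differentiableAt (by simp)).hasFDerivAt
  rw [((h.clm_apply (hasFDerivAt_const u y)).clm_apply (hasFDerivAt_const v y)).fderiv]
  simp

theorem Metric.fderiv_inChart_symm {x₀ : M} {y : E} (hy : y ∈ (extChartAt I x₀).target)
    (a u v : E) :
    fderiv ℝ (g.inChart x₀) y a u v = fderiv ℝ (g.inChart x₀) y a v u := by
  rw [← g.fderiv_inChart_apply hy, ← g.fderiv_inChart_apply hy]
  simp_rw [g.inChart_symm x₀ _ u v]

theorem Metric.christoffel_symm {x₀ : M} {y : E} (hy : y ∈ (extChartAt I x₀).target)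
    (u v : E) : g.christoffel x₀ y u v = g.christoffel x₀ y v u := by
  refine g.eq_of_inChart_eq hy fun w => ?_
  rw [g.inChart_christoffel hy, g.inChart_christoffel hy, g.fderiv_inChart_symm hy w u v]
  ring

/-- The Levi-Civita connection is metric. -/
theorem Metric.fderiv_inChart_eq {x₀ : M} {y : E} (hy : y ∈ (extChartAt I x₀).target)
    (a u v : E) :
    fderiv ℝ (g.inChart x₀) y a u v = g.inChart x₀ y (g.christoffel x₀ y a u) v
      + g.inChart x₀ y (g.christoffel x₀ y a v) u := by
  rw [g.inChart_christoffel hy, g.inChart_christoffel hy, g.fderiv_inChart_symm hy a v u,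
    g.fderiv_inChart_symm hy u a v, g.fderiv_inChart_symm hy v a u]
  ring

theorem Metric.contDiffAt_christoffel {x₀ : M} {y : E} (hy : y ∈ (extChartAt I x₀).target) :
    ContDiffAt ℝ ∞ (g.christoffel x₀) y := by
  have h1 : ContDiffAt ℝ ∞ (fderiv ℝ (g.inChart x₀)) y :=
    (g.contDiffAt_inChart hy).fderiv_right (by simp)
  have h2 : ContDiffAt ℝ ∞ (fun z => (fderiv ℝ (g.inChart x₀) z).flip) y :=
    (ContinuousLinearMap.flipₗᵢ ℝ E E (E →L[ℝ] ℝ)).contDiff.contDiffAt.comp y h1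
  have h3 : ContDiffAt ℝ ∞ (g.christoffelFirst x₀) y :=
    ((h1.add h2).sub (contDiffAt_const.clm_comp h2)).const_smul (1 / 2 : ℝ)
  exact ((ContinuousLinearMap.compL ℝ E (E →L[ℝ] ℝ) E).contDiff.contDiffAt.comp y
    (g.contDiffAt_inverse_inChart hy)).clm_comp h3

theorem Metric.hasFDerivAt_christoffel_apply {x₀ : M} {y : E}
    (hy : y ∈ (extChartAt I x₀).target) (u v : E) :
    HasFDerivAt (fun z => g.christoffel x₀ z u v)
      (((fderiv ℝ (g.christoffel x₀) y).flip u).flip v) y := by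
  have h := ((g.contDiffAt_christoffel hy).differentiableAt (by simp)).hasFDerivAt
  refine ((h.clm_apply (hasFDerivAt_const u y)).clm_apply (hasFDerivAt_const v y)).congr_fderiv ?_
  ext w
  simp

theorem Metric.fderiv_christoffel_symm {x₀ : M} {y : E} (hy : y ∈ (extChartAt I x₀).target)
    (a u v : E) :
    fderiv ℝ (g.christoffel x₀) y a u v = fderiv ℝ (g.christoffel x₀) y a v u := by
  have h : (fun z => g.christoffel x₀ z u v) =ᶠ[𝓝 y] fun z => g.christoffel x₀ z v u := by
    filter_upwards [(isOpen_extChartAt_target x₀).mem_nhds hy] with z hz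
    exact g.christoffel_symm hz u v
  have h1 := h.fderiv_eq (𝕜 := ℝ)
  rw [(g.hasFDerivAt_christoffel_apply hy u v).fderiv,
    (g.hasFDerivAt_christoffel_apply hy v u).fderiv] at h1
  exact congrArg (fun A : E →L[ℝ] E => A a) h1

theorem Metric.curvatureInChart_antisymm (x₀ : M) (y u v w : E) :
    g.curvatureInChart x₀ y u v w = -g.curvatureInChart x₀ y v u w := by
  rw [g.curvatureInChart_apply, g.curvatureInChart_apply]
  abel

/-- Symmetry of the Christoffel symbols, hence of their derivatives, makes the cyclic sum cancel in
pairs. -/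
theorem Metric.curvatureInChart_bianchi {x₀ : M} {y : E} (hy : y ∈ (extChartAt I x₀).target)
    (u v w : E) :
    g.curvatureInChart x₀ y u v w + g.curvatureInChart x₀ y v w u
      + g.curvatureInChart x₀ y w u v = 0 := by
  simp only [g.curvatureInChart_apply]
  rw [g.fderiv_christoffel_symm hy v u w, g.fderiv_christoffel_symm hy u v w,
    g.fderiv_christoffel_symm hy w v u, g.christoffel_symm hy u w, g.christoffel_symm hy v w,
    g.christoffel_symm hy v u]
  abel

/-- Metric compatibility holds on a neighbourhood of `y`, so it may be differentiated once more. -/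
theorem Metric.fderiv_fderiv_inChart {x₀ : M} {y : E} (hy : y ∈ (extChartAt I x₀).target)
    (d a u v : E) :
    fderiv ℝ (fderiv ℝ (g.inChart x₀)) y d a u v =
      g.inChart x₀ y (fderiv ℝ (g.christoffel x₀) y d a u) v
      + g.inChart x₀ y (fderiv ℝ (g.christoffel x₀) y d a v) u
      + fderiv ℝ (g.inChart x₀) y d (g.christoffel x₀ y a u) v
      + fderiv ℝ (g.inChart x₀) y d (g.christoffel x₀ y a v) u := by
  have h : (fun z => fderiv ℝ (g.inChart x₀) z a u v) =ᶠ[𝓝 y]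
      fun z => g.inChart x₀ z (g.christoffel x₀ z a u) v
        + g.inChart x₀ z (g.christoffel x₀ z a v) u := by
    filter_upwards [(isOpen_extChartAt_target x₀).mem_nhds hy] with z hz
    exact g.fderiv_inChart_eq hz a u v
  have hG := ((g.contDiffAt_inChart hy).differentiableAt (by simp)).hasFDerivAt
  have hD := (((g.contDiffAt_inChart hy).fderiv_right (m := ∞) (by simp)).differentiableAt
    (by simp)).hasFDerivAt
  have hl := ((hD.clm_apply (hasFDerivAt_const a y)).clm_apply
    (hasFDerivAt_const u y)).clm_apply (hasFDerivAt_const v y)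
  have hr := ((hG.clm_apply (g.hasFDerivAt_christoffel_apply hy a u)).clm_apply
    (hasFDerivAt_const v y)).add
    ((hG.clm_apply (g.hasFDerivAt_christoffel_apply hy a v)).clm_apply (hasFDerivAt_const u y))
  have h1 := hl.unique (hr.congr_of_eventuallyEq h)
  have h2 := congrArg (fun A : E →L[ℝ] ℝ => A d) h1
  simp at h2
  rw [h2]
  ring

/-- The second derivative of the metric is symmetric in `u, v`. Written through Christoffel symbols,
this symmetry is the claim. -/
theorem Metric.inChart_curvatureInChart_skew {x₀ : M} {y : E}
    (hy : y ∈ (extChartAt I x₀).target) (u v w z : E) :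
    g.inChart x₀ y (g.curvatureInChart x₀ y u v w) z =
      -g.inChart x₀ y (g.curvatureInChart x₀ y u v z) w := by
  have hs := ((g.contDiffAt_inChart hy).isSymmSndFDerivAt
    (by simpa using ENat.LEInfty.out)) u v
  have h1 := congrArg (fun A : E →L[ℝ] E →L[ℝ] ℝ => A w z) hs
  simp only [g.fderiv_fderiv_inChart hy, g.fderiv_inChart_eq hy] at h1
  simp only [g.curvatureInChart_apply, map_add, map_sub, add_apply, sub_apply]
  rw [g.inChart_symm x₀ y (g.christoffel x₀ y u z) (g.christoffel x₀ y v w),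
    g.inChart_symm x₀ y (g.christoffel x₀ y u w) (g.christoffel x₀ y v z)] at h1
  linarith

end Chart

end PseudoRiemannian
namespace PseudoRiemannian

open ContinuousLinearMap

/-! ### Algebra of curvature-like tensors over an indefinite scalar product -/

section Algebra

/-- Polarization in the second and fourth slots, then in the first and third, makes `S` alternate
under exchange of slots one and three. The three terms of the Bianchi sum are then equal. Additivity
in one slot passes to the others by the symmetries. -/
theorem eq_zero_of_biquadratic_eq_zero {E : Type*} [AddCommGroup E] (S : E → E → E → E → ℝ)
    (hadd₁ : ∀ u u' v w z, S (u + u') v w z = S u v w z + S u' v w z)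
    (hanti : ∀ u v w z, S u v w z = -S v u w z) (hskew : ∀ u v w z, S u v w z = -S u v z w)
    (hbianchi : ∀ u v w z, S u v w z + S v w u z + S w u v z = 0)
    (hS : ∀ u v, S u v u v = 0) (u v w z : E) : S u v w z = 0 := by
  -- The pair symmetry follows from four Bianchi identities and the two skew symmetries.
  have hpair : ∀ u v w z, S u v w z = S w z u v := fun u v w z => by
    linarith [hbianchi u v w z, hbianchi v w z u, hbianchi w z u v, hbianchi z u v w,
      hskew u v w z, hskew v w u z, hskew w u v z, hskew v w z u, hskew w z v u, hskew z v w u,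
      hskew w z u v, hskew z u w v, hskew u w z v, hskew z u v w, hskew u v z w, hskew v z u w,
      hanti u w v z, hanti v z w u, hanti u w z v, hanti v z u w]
  have hadd₂ : ∀ u v v' w z, S u (v + v') w z = S u v w z + S u v' w z := fun u v v' w z => by
    linarith [hanti u (v + v') w z, hadd₁ v v' u w z, hanti u v w z, hanti u v' w z]
  have hadd₃ : ∀ u v w w' z, S u v (w + w') z = S u v w z + S u v w' z := fun u v w w' z => by
    linarith [hpair u v (w + w') z, hadd₁ w w' z u v, hpair u v w z, hpair u v w' z]
  have hadd₄ : ∀ u v w z z', S u v w (z + z') = S u v w z + S u v w z' := fun u v w z z' => by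
    linarith [hpair u v w (z + z'), hadd₂ w z z' u v, hpair u v w z, hpair u v w z']
  have h1 : ∀ u v z, S u v u z = 0 := fun u v z => by
    linarith [hS u (v + z), hadd₂ u v z u (v + z), hadd₄ u v u v z, hadd₄ u z u v z, hS u v,
      hS u z, hpair u v u z]
  have h2 : ∀ u v w z, S u v w z = -S w v u z := fun u v w z => by
    linarith [h1 (u + w) v z, hadd₁ u w v (u + w) z, hadd₃ u v u w z, hadd₃ w v u w z, h1 u v z,
      h1 w v z]
  linarith [hbianchi u v w z, h2 u v w z, hanti w v u z, h2 v w u z, hanti u w v z]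

/-- A nonzero polynomial has finitely many roots, so `h` vanishes on a dense set, hence everywhere
by continuity. -/
theorem eq_zero_of_quartic_ne_zero {h : ℝ → ℝ} (hh : Continuous h) (a b c d e : ℝ) (he : e ≠ 0)
    (H : ∀ s, a + b * s + c * s ^ 2 + d * s ^ 3 + e * s ^ 4 ≠ 0 → h s = 0) : h 0 = 0 := by
  open Polynomial in
  let p : ℝ[X] := C a + C b * X + C c * X ^ 2 + C d * X ^ 3 + C e * X ^ 4
  have hp : p ≠ 0 := fun hp => he (by
    have := congrArg (fun q : Polynomial ℝ => q.coeff 4) hp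
    simpa [p, Polynomial.coeff_X, Polynomial.coeff_C, Polynomial.coeff_X_pow] using this)
  have hfin : {s | p.IsRoot s}.Finite := Polynomial.finite_setOfPred_isRoot hp
  have hd : Dense {s | p.IsRoot s}ᶜ := hfin.countable.dense_compl ℝ
  have : h = fun _ => 0 := by
    refine hh.ext_on hd continuous_const fun s hs => H s ?_
    simpa [p, Polynomial.IsRoot] using hs
  exact congrFun this 0

variable {E : Type*} [NormedAddCommGroup E] [NormedSpace ℝ E] [FiniteDimensional ℝ E]

/-- If every area vanished, polarization would give B(u,u)B(v,w) = B(u,v)B(u,w). With B(u,u) ≠ 0,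
any nonzero vector orthogonal to `u` would then lie in the radical of `B`. -/
theorem exists_area_ne_zero (hE : 3 ≤ Module.finrank ℝ E) (B : E →L[ℝ] E →L[ℝ] ℝ)
    (hsymm : ∀ u v, B u v = B v u) (hB : ∀ v, (∀ w, B v w = 0) → v = 0) :
    ∃ u v, B u u * B v v - B u v ^ 2 ≠ 0 := by
  by_contra! H
  have hpol : ∀ u v w, B u u * B v w = B u v * B u w := fun u v w => by
    have h1 := H u (v + w)
    simp only [map_add, add_apply] at h1
    rw [hsymm w v] at h1
    linarith [H u v, H u w]
  obtain ⟨u, hu⟩ : ∃ u, B u u ≠ 0 := by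
    by_contra! h0
    have : Nontrivial E := Module.nontrivial_of_finrank_pos (R := ℝ) (by omega)
    obtain ⟨x, hx⟩ := exists_ne (0 : E)
    refine hx (hB x fun w => ?_)
    have h1 := h0 (x + w)
    simp only [map_add, add_apply] at h1
    linarith [h0 x, h0 w, hsymm x w]
  have hker : 0 < Module.finrank ℝ (LinearMap.ker (B u : E →ₗ[ℝ] ℝ)) := by
    have h1 := LinearMap.finrank_range_add_finrank_ker (B u : E →ₗ[ℝ] ℝ)
    have h2 := Submodule.finrank_le (LinearMap.range (B u : E →ₗ[ℝ] ℝ))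
    rw [Module.finrank_self] at h2
    omega
  have := Module.nontrivial_of_finrank_pos hker
  obtain ⟨⟨w, hw⟩, hw0⟩ := exists_ne (0 : LinearMap.ker (B u : E →ₗ[ℝ] ℝ))
  have hw' : B u w = 0 := hw
  refine hw0 (Subtype.ext (hB w fun v => ?_))
  have h1 := hpol u w v
  rw [hw', zero_mul] at h1
  exact (mul_eq_zero.1 h1).resolve_left hu

/-- A curvature-like tensor with constant sectional curvature, also for an indefinite scalar
product. -/
theorem curvature_eq_of_sectional (hE : 3 ≤ Module.finrank ℝ E) (B : E →L[ℝ] E →L[ℝ] ℝ)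
    (hsymm : ∀ u v, B u v = B v u) (hB : ∀ v, (∀ w, B v w = 0) → v = 0)
    (R : E →L[ℝ] E →L[ℝ] E →L[ℝ] E) (hanti : ∀ u v w, R u v w = -R v u w)
    (hskew : ∀ u v w z, B (R u v w) z = -B (R u v z) w)
    (hbianchi : ∀ u v w, R u v w + R v w u + R w u v = 0) (κ : ℝ)
    (hκ : ∀ u v, B u u * B v v - B u v ^ 2 ≠ 0 →
      B (R u v u) v / (B u u * B v v - B u v ^ 2) = κ) (u v w : E) :
    R u v w = κ • (B u w • v - B v w • u) := by
  -- The defect from constant curvature. It has all the curvature symmetries and vanishes on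
  -- nondegenerate planes.
  let S : E → E → E → E → ℝ := fun u v w z =>
    B (R u v w) z - κ * (B u w * B v z - B v w * B u z)
  have hS₀ : ∀ u v, B u u * B v v - B u v ^ 2 ≠ 0 → S u v u v = 0 := fun u v h => by
    have h1 := (div_eq_iff h).1 (hκ u v h)
    simp only [S]
    rw [h1, hsymm v u]
    ring
  obtain ⟨u', v', h'⟩ := exists_area_ne_zero hE B hsymm hB
  have hS₁ : ∀ u v, S u v u v = 0 := fun u v => by
    -- An arbitrary plane is moved along a nondegenerate one. Its area is a quartic in `s` whose
    -- leading coefficient is the nonzero area of `u', v'`.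
    let h : ℝ → ℝ := fun s => S (u + s • u') (v + s • v') (u + s • u') (v + s • v')
    have hc : Continuous h := by
      simp only [h, S]
      fun_prop
    have h0 : h 0 = 0 := by
      refine eq_zero_of_quartic_ne_zero hc (B u u * B v v - B u v ^ 2)
        (2 * B u u' * B v v + 2 * B u u * B v v' - 2 * B u v * (B u v' + B u' v))
        (B u' u' * B v v + B u u * B v' v' + 4 * B u u' * B v v'
          - 2 * B u v * B u' v' - (B u v' + B u' v) ^ 2)
        (2 * B u' u' * B v v' + 2 * B u u' * B v' v' - 2 * B u' v' * (B u v' + B u' v))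
        (B u' u' * B v' v' - B u' v' ^ 2) h' fun s hs => ?_
      refine hS₀ _ _ fun hz => hs ?_
      rw [← hz]
      simp only [map_add, add_apply, map_smul, smul_apply, smul_eq_mul]
      rw [hsymm u' u, hsymm v' v]
      ring
    simpa [h] using h0
  have hS : ∀ u v w z, S u v w z = 0 := by
    refine eq_zero_of_biquadratic_eq_zero S ?_ ?_ ?_ ?_ hS₁
    · intro u u' v w z
      simp only [S, map_add, add_apply]
      ring
    · intro u v w z
      simp only [S]
      rw [hanti u v w, map_neg, neg_apply]
      ring
    · intro u v w z
      simp only [S]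
      rw [hskew u v w z]
      ring
    · intro u v w z
      have h1 := congrArg (fun x => B x z) (hbianchi u v w)
      simp only [map_add, add_apply, map_zero, zero_apply] at h1
      simp only [S]
      rw [hsymm v u, hsymm w u, hsymm w v]
      linear_combination h1
  refine sub_eq_zero.1 (hB _ fun z => ?_)
  have h1 := hS u v w z
  simp only [map_sub, sub_apply, map_smul, smul_apply, smul_eq_mul]
  exact h1

end Algebra

/-! ### Constant sectional curvature as an equation for the curvature tensor -/

section Sectional

variable {E : Type*} [NormedAddCommGroup E] [NormedSpace ℝ E] [FiniteDimensional ℝ E]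
  {H : Type*} [TopologicalSpace H] {I : ModelWithCorners ℝ E H} [I.Boundaryless]
  {M : Type*} [TopologicalSpace M] [ChartedSpace H M] [IsManifold I ∞ M] (g : Metric I M)

/-- Constant sectional curvature determines the curvature tensor. -/
theorem Metric.hasConstantSectionalCurvature_iff (hE : 3 ≤ Module.finrank ℝ E) (κ : ℝ) :
    g.HasConstantSectionalCurvature κ ↔ ∀ (x : M) (u v w : E),
      g.curvatureInChart x (extChartAt I x x) u v w =
        κ • (g.inChart x (extChartAt I x x) u w • v - g.inChart x (extChartAt I x x) v w • u) := by
  constructor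
  · intro h x u v w
    have hx := mem_extChartAt_target (I := I) x
    refine curvature_eq_of_sectional hE (g.inChart x (extChartAt I x x)) (g.inChart_symm x _)
      (fun v hv => g.inChart_nondegenerate hx hv) _ (g.curvatureInChart_antisymm x _)
      (g.inChart_curvatureInChart_skew hx) (g.curvatureInChart_bianchi hx) κ (fun u v => ?_) u v w
    simp only [g.inChart_self]
    exact h x u v
  · intro h x (u : E) (v : E) huv
    have h1 : g.val x (g.curvature x u v u) v = κ * g.areaSq x u v := by
      have h2 : g.inChart x (extChartAt I x x)
          (g.curvatureInChart x (extChartAt I x x) u v u) v = κ * (g.inChart x (extChartAt I x x) u u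
          * g.inChart x (extChartAt I x x) v v - g.inChart x (extChartAt I x x) u v ^ 2) := by
        rw [h x u v u]
        simp only [map_sub, sub_apply, map_smul, smul_apply, smul_eq_mul]
        rw [g.inChart_symm x _ v u]
        ring
      simp only [g.inChart_self] at h2
      exact h2
    exact (div_eq_iff huv).2 h1

end Sectional

end PseudoRiemannian
namespace PseudoRiemannian

open ContinuousLinearMap

/-! ### Change of charts and covariant derivatives -/

section ChartChange

variable {E : Type*} [NormedAddCommGroup E] [NormedSpace ℝ E]
  {H : Type*} [TopologicalSpace H] {I : ModelWithCorners ℝ E H} [I.Boundaryless]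
  {M : Type*} [TopologicalSpace M] [ChartedSpace H M] [IsManifold I ∞ M]

/-- The change of coordinates from the preferred chart at `x₁` to that at `x₀`. -/
noncomputable def coordChange (I : ModelWithCorners ℝ E H) (x₁ x₀ : M) (z : E) : E :=
  extChartAt I x₀ ((extChartAt I x₁).symm z)

/-- The domain of the change of coordinates. -/
noncomputable def overlap (I : ModelWithCorners ℝ E H) (x₁ x₀ : M) : Set E :=
  (extChartAt I x₁).target ∩ (extChartAt I x₁).symm ⁻¹' (extChartAt I x₀).source

theorem isOpen_overlap (x₁ x₀ : M) : IsOpen (overlap I x₁ x₀) :=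
  (continuousOn_extChartAt_symm x₁).isOpen_inter_preimage (isOpen_extChartAt_target x₁)
    (isOpen_extChartAt_source x₀)

theorem coordChange_mem_target {x₁ x₀ : M} {z : E} (hz : z ∈ overlap I x₁ x₀) :
    coordChange I x₁ x₀ z ∈ (extChartAt I x₀).target :=
  (extChartAt I x₀).map_source hz.2

theorem extChartAt_symm_coordChange {x₁ x₀ : M} {z : E} (hz : z ∈ overlap I x₁ x₀) :
    (extChartAt I x₀).symm (coordChange I x₁ x₀ z) = (extChartAt I x₁).symm z :=
  (extChartAt I x₀).left_inv hz.2

theorem mdifferentiableAt_extChartAt_symm {x₁ : M} {z : E} (hz : z ∈ (extChartAt I x₁).target) :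
    MDifferentiableAt 𝓘(ℝ, E) I (extChartAt I x₁).symm z :=
  ((contMDiffOn_extChartAt_symm (n := ∞) x₁).contMDiffAt
    ((isOpen_extChartAt_target x₁).mem_nhds hz)).mdifferentiableAt (by simp)

theorem contDiffAt_coordChange {x₁ x₀ : M} {z : E} (hz : z ∈ overlap I x₁ x₀) :
    ContDiffAt ℝ ∞ (coordChange I x₁ x₀) z := by
  have h1 : ContMDiffAt 𝓘(ℝ, E) I ∞ (extChartAt I x₁).symm z :=
    (contMDiffOn_extChartAt_symm (n := ∞) x₁).contMDiffAt
      ((isOpen_extChartAt_target x₁).mem_nhds hz.1)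
  have h2 : ContMDiffAt I 𝓘(ℝ, E) ∞ (extChartAt I x₀) ((extChartAt I x₁).symm z) :=
    contMDiffAt_extChartAt' (by rw [← extChartAt_source (I := I)]; exact hz.2)
  exact (h2.comp z h1).contDiffAt

theorem mfderiv_extChartAt_symm_coordChange {x₁ x₀ : M} {z : E} (hz : z ∈ overlap I x₁ x₀)
    (u : E) :
    (mfderiv 𝓘(ℝ, E) I (extChartAt I x₀).symm (coordChange I x₁ x₀ z)
      (fderiv ℝ (coordChange I x₁ x₀) z u) : E) =
    (mfderiv 𝓘(ℝ, E) I (extChartAt I x₁).symm z u : E) := by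
  have hd : MDifferentiableAt 𝓘(ℝ, E) 𝓘(ℝ, E) (coordChange I x₁ x₀) z :=
    ((contDiffAt_coordChange hz).differentiableAt (by simp)).mdifferentiableAt
  have h1 := mfderiv_comp_apply z
    (mdifferentiableAt_extChartAt_symm (coordChange_mem_target hz)) hd u
  have h2 : (extChartAt I x₀).symm ∘ coordChange I x₁ x₀ =ᶠ[𝓝 z] (extChartAt I x₁).symm := by
    filter_upwards [(isOpen_overlap x₁ x₀).mem_nhds hz] with y hy
    exact extChartAt_symm_coordChange hy
  have h3 := congrArg (fun A : E →L[ℝ] E => A u) (h2.mfderiv_eq (I := 𝓘(ℝ, E)) (I' := I))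
  rw [mfderiv_eq_fderiv] at h1
  exact h1.symm.trans h3

theorem fderiv_coordChange_apply {x₁ x₀ : M} {z : E} (hz : z ∈ overlap I x₁ x₀)
    (v : TangentSpace I ((extChartAt I x₁).symm z)) :
    fderiv ℝ (coordChange I x₁ x₀) z
      (mfderiv I 𝓘(ℝ, E) (extChartAt I x₁) ((extChartAt I x₁).symm z) v) =
    (mfderiv I 𝓘(ℝ, E) (extChartAt I x₀) ((extChartAt I x₁).symm z) v : E) := by
  have : IsManifold I 1 M := IsManifold.of_le (n := ∞) (by simp)
  have hd : MDifferentiableAt I 𝓘(ℝ, E) (extChartAt I x₀) ((extChartAt I x₁).symm z) :=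
    mdifferentiableAt_extChartAt (by rw [← extChartAt_source (I := I)]; exact hz.2)
  have h1 := mfderiv_comp_apply z hd (mdifferentiableAt_extChartAt_symm hz.1)
    (mfderiv I 𝓘(ℝ, E) (extChartAt I x₁) ((extChartAt I x₁).symm z) v)
  rw [mfderiv_extChartAt_symm_apply hz.1] at h1
  rw [← h1, mfderiv_eq_fderiv]
  rfl

/-- Equality of base points allows to compare components of a vector field. -/
theorem mfderiv_vectorField_congr (V : ∀ x : M, TangentSpace I x) (x₀ : M) {x x' : M}
    (h : x = x') : (mfderiv I 𝓘(ℝ, E) (extChartAt I x₀) x (V x) : E) =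
      (mfderiv I 𝓘(ℝ, E) (extChartAt I x₀) x' (V x') : E) := by
  subst h; rfl

theorem vectorFieldInChart_coordChange (V : ∀ x : M, TangentSpace I x) {x₁ x₀ : M} {z : E}
    (hz : z ∈ overlap I x₁ x₀) :
    vectorFieldInChart V x₀ (coordChange I x₁ x₀ z) =
      fderiv ℝ (coordChange I x₁ x₀) z (vectorFieldInChart V x₁ z) :=
  (mfderiv_vectorField_congr V x₀ (extChartAt_symm_coordChange hz)).trans
    (fderiv_coordChange_apply hz _).symm

theorem vectorFieldInChart_self (V : ∀ x : M, TangentSpace I x) (x : M) :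
    vectorFieldInChart V x (extChartAt I x x) = V x :=
  (mfderiv_vectorField_congr V x (extChartAt_to_inv (I := I) x)).trans
    (mfderiv_extChartAt_self (I := I) x (V x))

variable (g : Metric I M)

theorem Metric.inChart_coordChange {x₁ x₀ : M} {z : E} (hz : z ∈ overlap I x₁ x₀) (u v : E) :
    g.inChart x₀ (coordChange I x₁ x₀ z) (fderiv ℝ (coordChange I x₁ x₀) z u)
      (fderiv ℝ (coordChange I x₁ x₀) z v) = g.inChart x₁ z u v :=
  (g.inChart_eq x₀ _ _ _).trans ((tensor_congr g.val (extChartAt_symm_coordChange hz)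
    (mfderiv_extChartAt_symm_coordChange hz u)
    (mfderiv_extChartAt_symm_coordChange hz v)).trans (g.inChart_eq x₁ z u v).symm)

/-- The derivative of the tensor law for `g`. The last two terms come from the second derivative of
the coordinate change. -/
theorem Metric.fderiv_inChart_coordChange {x₁ x₀ : M} {z : E} (hz : z ∈ overlap I x₁ x₀)
    (a u v : E) :
    fderiv ℝ (g.inChart x₁) z a u v =
      fderiv ℝ (g.inChart x₀) (coordChange I x₁ x₀ z) (fderiv ℝ (coordChange I x₁ x₀) z a)
        (fderiv ℝ (coordChange I x₁ x₀) z u) (fderiv ℝ (coordChange I x₁ x₀) z v)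
      + g.inChart x₀ (coordChange I x₁ x₀ z) (fderiv ℝ (fderiv ℝ (coordChange I x₁ x₀)) z a u)
        (fderiv ℝ (coordChange I x₁ x₀) z v)
      + g.inChart x₀ (coordChange I x₁ x₀ z) (fderiv ℝ (fderiv ℝ (coordChange I x₁ x₀)) z a v)
        (fderiv ℝ (coordChange I x₁ x₀) z u) := by
  set ψ := coordChange I x₁ x₀
  have hψ : HasFDerivAt ψ (fderiv ℝ ψ z) z :=
    ((contDiffAt_coordChange hz).differentiableAt (by simp)).hasFDerivAt
  have hψ' : HasFDerivAt (fderiv ℝ ψ) (fderiv ℝ (fderiv ℝ ψ) z) z :=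
    (((contDiffAt_coordChange hz).fderiv_right (m := ∞) (by simp)).differentiableAt
      (by simp)).hasFDerivAt
  have hG₀ := ((g.contDiffAt_inChart (coordChange_mem_target hz)).differentiableAt
    (by simp)).hasFDerivAt.comp z hψ
  have hG₁ := ((g.contDiffAt_inChart hz.1).differentiableAt (by simp)).hasFDerivAt
  have hl := (hG₁.clm_apply (hasFDerivAt_const u z)).clm_apply (hasFDerivAt_const v z)
  have hr := (hG₀.clm_apply (hψ'.clm_apply (hasFDerivAt_const u z))).clm_apply
    (hψ'.clm_apply (hasFDerivAt_const v z))
  have he : (fun y => g.inChart x₁ y u v) =ᶠ[𝓝 z]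
      fun y => (g.inChart x₀ ∘ ψ) y (fderiv ℝ ψ y u) (fderiv ℝ ψ y v) := by
    filter_upwards [(isOpen_overlap x₁ x₀).mem_nhds hz] with y hy
    exact (g.inChart_coordChange hy u v).symm
  have h1 := congrArg (fun A : E →L[ℝ] ℝ => A a) (hl.unique (hr.congr_of_eventuallyEq he))
  simp at h1
  rw [h1, g.inChart_symm x₀ _ (fderiv ℝ (fderiv ℝ ψ) z a v)]
  ring

variable [FiniteDimensional ℝ E]

theorem fderiv_coordChange_surjective {x₁ x₀ : M} {z : E} (hz : z ∈ overlap I x₁ x₀) :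
    Function.Surjective (fderiv ℝ (coordChange I x₁ x₀) z) := by
  refine LinearMap.injective_iff_surjective (f := (fderiv ℝ (coordChange I x₁ x₀) z : E →ₗ[ℝ] E)).1
    ((injective_iff_map_eq_zero _).2 fun v hv => ?_)
  refine mfderiv_extChartAt_symm_injective hz.1 ?_
  rw [← mfderiv_extChartAt_symm_coordChange hz]
  let A : E →L[ℝ] E := mfderiv 𝓘(ℝ, E) I (extChartAt I x₀).symm (coordChange I x₁ x₀ z)
  exact (congrArg A hv).trans A.map_zero

/-- The transformation law of the Christoffel symbols. -/
theorem Metric.christoffel_coordChange {x₁ x₀ : M} {z : E} (hz : z ∈ overlap I x₁ x₀) (u v : E) :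
    g.christoffel x₀ (coordChange I x₁ x₀ z) (fderiv ℝ (coordChange I x₁ x₀) z u)
      (fderiv ℝ (coordChange I x₁ x₀) z v) + fderiv ℝ (fderiv ℝ (coordChange I x₁ x₀)) z u v =
    fderiv ℝ (coordChange I x₁ x₀) z (g.christoffel x₁ z u v) := by
  have ht := coordChange_mem_target hz
  refine g.eq_of_inChart_eq ht fun w' => ?_
  obtain ⟨w, rfl⟩ := fderiv_coordChange_surjective hz w'
  -- Six second-derivative terms enter the Koszul combination. By symmetry four of them cancel and
  -- two agree.
  have hs := (contDiffAt_coordChange hz).isSymmSndFDerivAt (by simpa using ENat.LEInfty.out)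
  rw [map_add, add_apply, g.inChart_coordChange hz, g.inChart_christoffel hz.1,
    g.inChart_christoffel ht, g.fderiv_inChart_coordChange hz, g.fderiv_inChart_coordChange hz,
    g.fderiv_inChart_coordChange hz, hs v u, hs w u, hs w v]
  ring

/-- The components in the preferred chart at `x₀` of the covariant derivative `∇_X V`. -/
noncomputable def Metric.covDerivInChart (V : E → E) (x₀ : M) (y X : E) : E :=
  fderiv ℝ V y X + g.christoffel x₀ y X (V y)

/-- The second derivative of the coordinate change produced by differentiating the components of `V`
cancels the inhomogeneous term of the Christoffel law. -/
theorem Metric.covDerivInChart_coordChange (V : ∀ x : M, TangentSpace I x) {x₁ x₀ : M} {z : E}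
    (hz : z ∈ overlap I x₁ x₀)
    (h₀ : DifferentiableAt ℝ (vectorFieldInChart V x₀) (coordChange I x₁ x₀ z))
    (h₁ : DifferentiableAt ℝ (vectorFieldInChart V x₁) z) (X : E) :
    g.covDerivInChart (vectorFieldInChart V x₀) x₀ (coordChange I x₁ x₀ z)
        (fderiv ℝ (coordChange I x₁ x₀) z X) =
      fderiv ℝ (coordChange I x₁ x₀) z
        (g.covDerivInChart (vectorFieldInChart V x₁) x₁ z X) := by
  have hψ := ((contDiffAt_coordChange hz).differentiableAt (by simp)).hasFDerivAt
  have hψ' := (((contDiffAt_coordChange hz).fderiv_right (m := ∞) (by simp)).differentiableAt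
    (by simp)).hasFDerivAt
  have hl := h₀.hasFDerivAt.comp z hψ
  have hr := hψ'.clm_apply h₁.hasFDerivAt
  have he : vectorFieldInChart V x₀ ∘ coordChange I x₁ x₀ =ᶠ[𝓝 z]
      fun y => fderiv ℝ (coordChange I x₁ x₀) y (vectorFieldInChart V x₁ y) := by
    filter_upwards [(isOpen_overlap x₁ x₀).mem_nhds hz] with y hy
    exact vectorFieldInChart_coordChange V hy
  have h1 := congrArg (fun A : E →L[ℝ] E => A X) (hl.unique (hr.congr_of_eventuallyEq he))
  simp at h1
  rw [Metric.covDerivInChart, Metric.covDerivInChart, map_add, h1,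
    vectorFieldInChart_coordChange V hz, ← g.christoffel_coordChange hz]
  abel

theorem Metric.covDeriv_eq (V : ∀ x : M, TangentSpace I x) (x : M) (X : E) :
    g.covDeriv V x X = g.covDerivInChart (vectorFieldInChart V x) x (extChartAt I x x) X := by
  rw [Metric.covDerivInChart, vectorFieldInChart_self]
  rfl

/-! ### Gradient and Hessian in a chart -/

section Gradient

variable {f : M → ℝ} (hf : ContMDiff I 𝓘(ℝ, ℝ) ∞ f)

include hf

theorem contDiffAt_comp_extChartAt_symm {x₀ : M} {y : E} (hy : y ∈ (extChartAt I x₀).target) :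
    ContDiffAt ℝ ∞ (f ∘ (extChartAt I x₀).symm) y :=
  (hf.contMDiffAt.comp y ((contMDiffOn_extChartAt_symm (n := ∞) x₀).contMDiffAt
      ((isOpen_extChartAt_target x₀).mem_nhds hy))).contDiffAt

theorem Metric.inChart_grad {x₀ : M} {y : E} (hy : y ∈ (extChartAt I x₀).target) (w : E) :
    g.inChart x₀ y (vectorFieldInChart (g.grad f) x₀ y) w =
      fderiv ℝ (f ∘ (extChartAt I x₀).symm) y w := by
  have h1 : g.inChart x₀ y (vectorFieldInChart (g.grad f) x₀ y) w =
      g.val ((extChartAt I x₀).symm y) (g.grad f ((extChartAt I x₀).symm y))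
        (mfderiv 𝓘(ℝ, E) I (extChartAt I x₀).symm y w) :=
    (g.inChart_eq x₀ y _ w).trans
      (tensor_congr g.val rfl (mfderiv_extChartAt_symm_apply hy _) rfl)
  have h2 : g.val ((extChartAt I x₀).symm y) (g.grad f ((extChartAt I x₀).symm y)) =
      mfderiv I 𝓘(ℝ, ℝ) f ((extChartAt I x₀).symm y) :=
    (g.isInvertible_val _).self_apply_inverse _
  rw [h1, h2, ← mfderiv_eq_fderiv]
  exact (mfderiv_comp_apply y (hf.mdifferentiableAt (by simp))
    (mdifferentiableAt_extChartAt_symm hy) w).symm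

/-- Near `y` the components are the inverse metric applied to the differential of `f`, both smooth.
-/
theorem Metric.contDiffAt_grad {x₀ : M} {y : E} (hy : y ∈ (extChartAt I x₀).target) :
    ContDiffAt ℝ ∞ (vectorFieldInChart (g.grad f) x₀) y := by
  have h : vectorFieldInChart (g.grad f) x₀ =ᶠ[𝓝 y] fun z =>
      inverse (g.inChart x₀ z) (fderiv ℝ (f ∘ (extChartAt I x₀).symm) z) := by
    filter_upwards [(isOpen_extChartAt_target x₀).mem_nhds hy] with z hz
    refine g.eq_of_inChart_eq hz fun w => ?_
    rw [g.inChart_inverse hz, g.inChart_grad hf hz]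
  refine ContDiffAt.congr_of_eventuallyEq ?_ h
  exact (g.contDiffAt_inverse_inChart hy).clm_apply
    ((contDiffAt_comp_extChartAt_symm hf hy).fderiv_right (by simp))

/-- The Hessian of a function is obtained from the covariant derivative of its gradient by
lowering an index. -/
theorem Metric.inChart_covDerivInChart_grad {x₀ : M} {y : E} (hy : y ∈ (extChartAt I x₀).target)
    (X Z : E) :
    g.inChart x₀ y (g.covDerivInChart (vectorFieldInChart (g.grad f) x₀) x₀ y X) Z =
      fderiv ℝ (fderiv ℝ (f ∘ (extChartAt I x₀).symm)) y X Z
        - fderiv ℝ (f ∘ (extChartAt I x₀).symm) y (g.christoffel x₀ y X Z) := by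
  have hG := ((g.contDiffAt_inChart hy).differentiableAt (by simp)).hasFDerivAt
  have hV := ((g.contDiffAt_grad hf hy).differentiableAt (by simp)).hasFDerivAt
  have hF := (((contDiffAt_comp_extChartAt_symm hf hy).fderiv_right (m := ∞)
    (by simp)).differentiableAt (by simp)).hasFDerivAt
  have hl := (hG.clm_apply hV).clm_apply (hasFDerivAt_const Z y)
  have hr := hF.clm_apply (hasFDerivAt_const Z y)
  have he : (fun z => g.inChart x₀ z (vectorFieldInChart (g.grad f) x₀ z) Z) =ᶠ[𝓝 y]
      fun z => fderiv ℝ (f ∘ (extChartAt I x₀).symm) z Z := by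
    filter_upwards [(isOpen_extChartAt_target x₀).mem_nhds hy] with z hz
    exact g.inChart_grad hf hz Z
  have h1 := congrArg (fun A : E →L[ℝ] ℝ => A X) (hl.unique (hr.congr_of_eventuallyEq he))
  simp only [add_apply, comp_apply, flip_apply, zero_apply, map_zero, zero_add] at h1
  rw [← h1, ← g.inChart_grad hf hy, Metric.covDerivInChart, map_add, add_apply,
    g.fderiv_inChart_eq hy,
    g.inChart_symm x₀ y _ (g.christoffel x₀ y X Z)]
  ring

end Gradient

end ChartChange

end PseudoRiemannian
namespace PseudoRiemannian

open ContinuousLinearMap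

/-! ### Connection and curvature of the static metric -/

section StaticCurvature

variable {E : Type*} [NormedAddCommGroup E] [NormedSpace ℝ E] [FiniteDimensional ℝ E]
  {M : Type*} [TopologicalSpace M] [ChartedSpace E M] [IsManifold 𝓘(ℝ, E) ∞ M]
  (g : Metric 𝓘(ℝ, E) M) (J : TopologicalSpace.Opens ℝ) {f : M → ℝ}
  (hf : ContMDiff 𝓘(ℝ, E) 𝓘(ℝ, ℝ) ∞ f) (hpos : ∀ x, 0 < f x)

theorem snd_mem_target_of_mem {p : J × M} {y : ℝ × E}
    (hy : y ∈ (extChartAt (𝓘(ℝ, ℝ).prod 𝓘(ℝ, E)) p).target) :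
    y.2 ∈ (extChartAt 𝓘(ℝ, E) p.2).target := by
  rw [extChartAt_prod] at hy
  exact hy.2

theorem staticMetric_inChart {p : J × M} {y : ℝ × E}
    (hy : y ∈ (extChartAt (𝓘(ℝ, ℝ).prod 𝓘(ℝ, E)) p).target) (v w : ℝ × E) :
    (staticMetric J f hf hpos g).inChart p y v w =
      -((f ∘ (extChartAt 𝓘(ℝ, E) p.2).symm) y.2 ^ 2) * (v.1 * w.1)
        + g.inChart p.2 y.2 v.2 w.2 :=
  staticTensor_inChart J f g p y hy v w

theorem staticMetric_fderiv_inChart {p : J × M} {y : ℝ × E}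
    (hy : y ∈ (extChartAt (𝓘(ℝ, ℝ).prod 𝓘(ℝ, E)) p).target) (a v w : ℝ × E) :
    fderiv ℝ ((staticMetric J f hf hpos g).inChart p) y a v w =
      -2 * (f ∘ (extChartAt 𝓘(ℝ, E) p.2).symm) y.2
        * fderiv ℝ (f ∘ (extChartAt 𝓘(ℝ, E) p.2).symm) y.2 a.2 * (v.1 * w.1)
        + fderiv ℝ (g.inChart p.2) y.2 a.2 v.2 w.2 := by
  have hy2 := snd_mem_target_of_mem J hy
  have hF := ((contDiffAt_comp_extChartAt_symm hf hy2).differentiableAt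
    (by simp)).hasFDerivAt.comp y hasFDerivAt_snd
  have hG := ((g.contDiffAt_inChart hy2).differentiableAt (by simp)).hasFDerivAt.comp y
    hasFDerivAt_snd
  have hl := (((staticMetric J f hf hpos g).contDiffAt_inChart hy).differentiableAt
    (by simp)).hasFDerivAt
  have hl := (hl.clm_apply (hasFDerivAt_const v y)).clm_apply (hasFDerivAt_const w y)
  have hr := (((hF.pow 2).neg.mul_const (v.1 * w.1)).add
    ((hG.clm_apply (hasFDerivAt_const v.2 y)).clm_apply (hasFDerivAt_const w.2 y)))
  have he : (fun z => (staticMetric J f hf hpos g).inChart p z v w) =ᶠ[𝓝 y] fun z =>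
      -((f ∘ (extChartAt 𝓘(ℝ, E) p.2).symm) z.2 ^ 2) * (v.1 * w.1)
        + g.inChart p.2 z.2 v.2 w.2 := by
    filter_upwards [(isOpen_extChartAt_target p).mem_nhds hy] with z hz
    exact staticMetric_inChart g J hf hpos hz v w
  have h1 := congrArg (fun A : ℝ × E →L[ℝ] ℝ => A a) (hl.unique (hr.congr_of_eventuallyEq he))
  simp only [add_apply, comp_apply, flip_apply, zero_apply, map_zero, zero_add, smul_apply,
    neg_apply, coe_snd', smul_eq_mul, Function.comp_apply, nsmul_eq_mul] at h1
  rw [h1]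
  simp only [Function.comp_apply]
  ring

/-- Checked after lowering the index, by nondegeneracy. The mixed terms are (X f / f) ∂t, and Γ(∂t,
∂t) = f grad f. -/
theorem staticMetric_christoffel {p : J × M} {y : ℝ × E}
    (hy : y ∈ (extChartAt (𝓘(ℝ, ℝ).prod 𝓘(ℝ, E)) p).target) (u v : ℝ × E) :
    (staticMetric J f hf hpos g).christoffel p y u v =
      (((f ∘ (extChartAt 𝓘(ℝ, E) p.2).symm) y.2)⁻¹ *
        (u.1 * fderiv ℝ (f ∘ (extChartAt 𝓘(ℝ, E) p.2).symm) y.2 v.2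
          + v.1 * fderiv ℝ (f ∘ (extChartAt 𝓘(ℝ, E) p.2).symm) y.2 u.2),
        g.christoffel p.2 y.2 u.2 v.2 + (u.1 * v.1) •
          ((f ∘ (extChartAt 𝓘(ℝ, E) p.2).symm) y.2 •
            vectorFieldInChart (g.grad f) p.2 y.2)) := by
  have hy2 := snd_mem_target_of_mem J hy
  have hF : (f ∘ (extChartAt 𝓘(ℝ, E) p.2).symm) y.2 ≠ 0 := (hpos _).ne'
  refine (staticMetric J f hf hpos g).eq_of_inChart_eq hy fun w => ?_
  rw [(staticMetric J f hf hpos g).inChart_christoffel hy, staticMetric_inChart g J hf hpos hy,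
    staticMetric_fderiv_inChart g J hf hpos hy, staticMetric_fderiv_inChart g J hf hpos hy,
    staticMetric_fderiv_inChart g J hf hpos hy]
  simp only [map_add, map_smul, add_apply, smul_apply, smul_eq_mul]
  rw [g.inChart_christoffel hy2, g.inChart_grad hf hy2]
  field_simp
  ring

/-- The formula for the symbols holds near `y`, and its entries depend only on the M-coordinate. `F`
and `V` are variables with defining equations so that simplification does not unfold them. -/
theorem staticMetric_fderiv_christoffel {p : J × M} {y : ℝ × E}
    (hy : y ∈ (extChartAt (𝓘(ℝ, ℝ).prod 𝓘(ℝ, E)) p).target) {F : E → ℝ}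
    (hFdef : F = f ∘ (extChartAt 𝓘(ℝ, E) p.2).symm) {V : E → E}
    (hVdef : V = vectorFieldInChart (g.grad f) p.2) (a u v : ℝ × E) :
    fderiv ℝ ((staticMetric J f hf hpos g).christoffel p) y a u v =
      ((F y.2)⁻¹ * (u.1 * fderiv ℝ (fderiv ℝ F) y.2 a.2 v.2
          + v.1 * fderiv ℝ (fderiv ℝ F) y.2 a.2 u.2)
        - (F y.2 ^ 2)⁻¹ * fderiv ℝ F y.2 a.2
          * (u.1 * fderiv ℝ F y.2 v.2 + v.1 * fderiv ℝ F y.2 u.2),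
        fderiv ℝ (g.christoffel p.2) y.2 a.2 u.2 v.2 + (u.1 * v.1) •
          (F y.2 • fderiv ℝ V y.2 a.2 + fderiv ℝ F y.2 a.2 • V y.2)) := by
  have hy2 := snd_mem_target_of_mem J hy
  have hF0 : F y.2 ≠ 0 := by rw [hFdef]; exact (hpos _).ne'
  have hFs : ContDiffAt ℝ ∞ F y.2 := by
    rw [hFdef]; exact contDiffAt_comp_extChartAt_symm hf hy2
  have hVs : ContDiffAt ℝ ∞ V y.2 := by rw [hVdef]; exact g.contDiffAt_grad hf hy2
  have hF := (hFs.differentiableAt (by simp)).hasFDerivAt.comp y hasFDerivAt_snd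
  have hdF := ((hFs.fderiv_right (m := ∞) (by simp)).differentiableAt
    (by simp)).hasFDerivAt.comp y hasFDerivAt_snd
  have hV := (hVs.differentiableAt (by simp)).hasFDerivAt.comp y hasFDerivAt_snd
  have hΓ := (g.hasFDerivAt_christoffel_apply hy2 u.2 v.2).comp y hasFDerivAt_snd
  have hl := (staticMetric J f hf hpos g).hasFDerivAt_christoffel_apply hy u v
  have hinv := (hasFDerivAt_inv hF0).comp y hF
  have hr := (hinv.mul (((hdF.clm_apply (hasFDerivAt_const v.2 y)).const_mul u.1).add
    ((hdF.clm_apply (hasFDerivAt_const u.2 y)).const_mul v.1))).prodMk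
    (hΓ.add ((hF.smul hV).const_smul (u.1 * v.1)))
  have he : (fun z => (staticMetric J f hf hpos g).christoffel p z u v) =ᶠ[𝓝 y] fun z =>
      ((F z.2)⁻¹ * (u.1 * fderiv ℝ F z.2 v.2 + v.1 * fderiv ℝ F z.2 u.2),
        g.christoffel p.2 z.2 u.2 v.2 + (u.1 * v.1) • (F z.2 • V z.2)) := by
    filter_upwards [(isOpen_extChartAt_target p).mem_nhds hy] with z hz
    rw [hFdef, hVdef]
    exact staticMetric_christoffel g J hf hpos hz u v
  have h1 := congrArg (fun A : ℝ × E →L[ℝ] ℝ × E => A a)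
    (hl.unique (hr.congr_of_eventuallyEq he))
  refine h1.trans (Prod.ext ?_ ?_)
  · simp
    ring
  · simp

/-- The curvature of a standard static space-time. -/
theorem staticMetric_curvatureInChart {p : J × M} {y : ℝ × E}
    (hy : y ∈ (extChartAt (𝓘(ℝ, ℝ).prod 𝓘(ℝ, E)) p).target) {F : E → ℝ}
    (hFdef : F = f ∘ (extChartAt 𝓘(ℝ, E) p.2).symm) {V : E → E}
    (hVdef : V = vectorFieldInChart (g.grad f) p.2) (X Y Z : ℝ × E) :
    (staticMetric J f hf hpos g).curvatureInChart p y X Y Z =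
      ((F y.2)⁻¹ * (X.1 * g.inChart p.2 y.2 (g.covDerivInChart V p.2 y.2 Y.2) Z.2
          - Y.1 * g.inChart p.2 y.2 (g.covDerivInChart V p.2 y.2 X.2) Z.2),
        g.curvatureInChart p.2 y.2 X.2 Y.2 Z.2
          + (F y.2 * Z.1) • (X.1 • g.covDerivInChart V p.2 y.2 Y.2
            - Y.1 • g.covDerivInChart V p.2 y.2 X.2)) := by
  have hy2 := snd_mem_target_of_mem J hy
  have hF0 : F y.2 ≠ 0 := by rw [hFdef]; exact (hpos _).ne'
  have hFs : ContDiffAt ℝ ∞ F y.2 := by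
    rw [hFdef]; exact contDiffAt_comp_extChartAt_symm hf hy2
  have hs := hFs.isSymmSndFDerivAt (by simpa using ENat.LEInfty.out)
  have hH : ∀ U W, g.inChart p.2 y.2 (g.covDerivInChart V p.2 y.2 U) W =
      fderiv ℝ (fderiv ℝ F) y.2 U W - fderiv ℝ F y.2 (g.christoffel p.2 y.2 U W) := by
    rw [hFdef, hVdef]; exact g.inChart_covDerivInChart_grad hf hy2
  have hΓ : ∀ u v, (staticMetric J f hf hpos g).christoffel p y u v =
      ((F y.2)⁻¹ * (u.1 * fderiv ℝ F y.2 v.2 + v.1 * fderiv ℝ F y.2 u.2),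
        g.christoffel p.2 y.2 u.2 v.2 + (u.1 * v.1) • (F y.2 • V y.2)) := by
    rw [hFdef, hVdef]; exact staticMetric_christoffel g J hf hpos hy
  rw [Metric.curvatureInChart_apply]
  simp only [staticMetric_fderiv_christoffel g J hf hpos hy hFdef hVdef, hΓ, hH]
  refine Prod.ext ?_ ?_
  · simp only [Prod.fst_add, Prod.fst_sub, map_add, map_smul, smul_eq_mul]
    -- The second derivatives of `F` multiplied by `Z.1` cancel by symmetry.
    rw [hs Y.2 X.2]
    field_simp
    ring
  · simp only [Prod.snd_add, Prod.snd_sub, map_add, map_smul, g.curvatureInChart_apply,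
      Metric.covDerivInChart]

    match_scalars <;> field_simp
    ring

end StaticCurvature

end PseudoRiemannian
namespace PseudoRiemannian

open ContinuousLinearMap

/-! ### Functions with vanishing derivative -/

section LocallyConstant

variable {E : Type*} [NormedAddCommGroup E] [NormedSpace ℝ E]
  {H : Type*} [TopologicalSpace H] {I : ModelWithCorners ℝ E H} [I.Boundaryless]
  {M : Type*} [TopologicalSpace M] [ChartedSpace H M]

/-- It suffices to compute the derivative of a function in the preferred chart at the point. -/
theorem hasMFDerivAt_of_comp_extChartAt_symm {K : M → ℝ} {x : M} {L : E →L[ℝ] ℝ}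
    (h : HasFDerivAt (K ∘ (extChartAt I x).symm) L (extChartAt I x x)) :
    HasMFDerivAt I 𝓘(ℝ, ℝ) K x L := by
  refine ⟨?_, h.hasFDerivWithinAt⟩
  have h1 : ContinuousAt ((K ∘ (extChartAt I x).symm) ∘ extChartAt I x) x :=
    ContinuousAt.comp h.continuousAt (continuousAt_extChartAt x)
  refine h1.congr ?_
  filter_upwards [extChartAt_source_mem_nhds (I := I) x] with z hz
  exact congrArg K ((extChartAt I x).left_inv hz)

/-- A ball in the chart is connected, and the derivative vanishes on it. -/
theorem isLocallyConstant_of_hasMFDerivAt_zero [IsManifold I ∞ M] {K : M → ℝ}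
    (h : ∀ x, HasMFDerivAt I 𝓘(ℝ, ℝ) K x (0 : E →L[ℝ] ℝ)) : IsLocallyConstant K := by
  refine (IsLocallyConstant.iff_eventually_eq K).2 fun x => ?_
  obtain ⟨r, hr, hb⟩ := _root_.Metric.mem_nhds_iff.1 (extChartAt_target_mem_nhds (I := I) x)
  have hd : ∀ y ∈ _root_.Metric.ball (extChartAt I x x) r,
      HasFDerivAt (K ∘ (extChartAt I x).symm) (0 : E →L[ℝ] ℝ) y := by
    intro y hy
    have h1 := ((h ((extChartAt I x).symm y)).comp y
      (mdifferentiableAt_extChartAt_symm (hb hy)).hasMFDerivAt)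
    exact (h1.hasFDerivAt).congr_fderiv (ContinuousLinearMap.zero_comp _)
  have hc := fun y hy => _root_.Metric.isOpen_ball.is_const_of_fderiv_eq_zero
    (_root_.convex_ball (extChartAt I x x) r).isPreconnected
    (fun y hy => (hd y hy).differentiableAt.differentiableWithinAt)
    (fun y hy => (hd y hy).fderiv) (x := y) hy (_root_.Metric.mem_ball_self hr)
  filter_upwards [(continuousAt_extChartAt (I := I) x).preimage_mem_nhds
    (_root_.Metric.ball_mem_nhds _ hr), extChartAt_source_mem_nhds (I := I) x] with z hz hz'
  have h1 := hc _ hz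
  simp only [Function.comp_apply] at h1
  rwa [(extChartAt I x).left_inv hz', extChartAt_to_inv] at h1

end LocallyConstant

/-! ### The Ricci identity for a concircular gradient -/

section ConcircularGradient

variable {E : Type*} [NormedAddCommGroup E] [NormedSpace ℝ E] [FiniteDimensional ℝ E]
  {H : Type*} [TopologicalSpace H] {I : ModelWithCorners ℝ E H} [I.Boundaryless]
  {M : Type*} [TopologicalSpace M] [ChartedSpace H M] [IsManifold I ∞ M] (g : Metric I M)

/-- The hypothesis speaks at each point in its own chart. Transport to one fixed chart makes the
equation available on an open set, where it can be differentiated. -/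
theorem Metric.covDerivInChart_of_covDeriv {V : ∀ x : M, TangentSpace I x} {c : M → ℝ} {x₀ : M}
    {y : E} (hy : y ∈ (extChartAt I x₀).target)
    (hV : ∀ (x₁ : M) (z : E), z ∈ (extChartAt I x₁).target →
      DifferentiableAt ℝ (vectorFieldInChart V x₁) z)
    (hc : ∀ (x : M) (X : E), g.covDeriv V x X = (c x • X : E)) (X : E) :
    g.covDerivInChart (vectorFieldInChart V x₀) x₀ y X = c ((extChartAt I x₀).symm y) • X := by
  set x₁ := (extChartAt I x₀).symm y with hx₁
  set z := extChartAt I x₁ x₁ with hz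
  have hinv : (extChartAt I x₁).symm z = x₁ := extChartAt_to_inv x₁
  have hzo : z ∈ overlap I x₁ x₀ := by
    refine ⟨mem_extChartAt_target x₁, ?_⟩
    rw [mem_preimage, hinv]
    exact (extChartAt I x₀).map_target hy
  have hψ : coordChange I x₁ x₀ z = y := by
    rw [coordChange, hinv, hx₁]
    exact (extChartAt I x₀).right_inv hy
  obtain ⟨X', rfl⟩ := fderiv_coordChange_surjective hzo X
  have h1 := g.covDerivInChart_coordChange V hzo (hV x₀ _ (coordChange_mem_target hzo))
    (hV x₁ z hzo.1) X'
  rw [← g.covDeriv_eq V x₁ X', hc, hψ] at h1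
  rw [h1, map_smul]

/-- The Ricci identity for a vector field `V` with `∇_X V = c X`. -/
theorem Metric.curvatureInChart_of_covDerivInChart {V : E → E} {x₀ : M} {y : E}
    (hy : y ∈ (extChartAt I x₀).target) (hV : ContDiffAt ℝ ∞ V y) {c : E → ℝ} {c' : E →L[ℝ] ℝ}
    (hc : HasFDerivAt c c' y) (hN : ∀ᶠ z in 𝓝 y, ∀ X, g.covDerivInChart V x₀ z X = c z • X)
    (X Y : E) :
    g.curvatureInChart x₀ y X Y (V y) = c' Y • X - c' X • Y := by
  have hVd := (hV.differentiableAt (by simp)).hasFDerivAt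
  have hV' := ((hV.fderiv_right (m := ∞) (by simp)).differentiableAt (by simp)).hasFDerivAt
  have hs := hV.isSymmSndFDerivAt (by simpa using ENat.LEInfty.out)
  have hΓ := ((g.contDiffAt_christoffel hy).differentiableAt (by simp)).hasFDerivAt
  -- The equation ∇_X V = c X differentiated along `Y`, with the first derivative of `V` eliminated
  -- by the same equation. Antisymmetrizing in `X, Y` produces the curvature.
  have key : ∀ X Y, fderiv ℝ (fderiv ℝ V) y Y X + fderiv ℝ (g.christoffel x₀) y Y X (V y)
      + g.christoffel x₀ y X (c y • Y - g.christoffel x₀ y Y (V y)) = c' Y • X := by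
    intro X Y
    have hl := (hV'.clm_apply (hasFDerivAt_const X y)).add
      ((hΓ.clm_apply (hasFDerivAt_const X y)).clm_apply hVd)
    have hr := hc.smul_const X
    have he : (fun z => fderiv ℝ V z X + g.christoffel x₀ z X (V z)) =ᶠ[𝓝 y]
        fun z => c z • X := by
      filter_upwards [hN] with z hz
      exact hz X
    have h1 := congrArg (fun A : E →L[ℝ] E => A Y) (hl.unique (hr.congr_of_eventuallyEq he))
    have h2 : fderiv ℝ V y Y = c y • Y - g.christoffel x₀ y Y (V y) :=
      eq_sub_of_add_eq (hN.self_of_nhds Y)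
    simp only [add_apply, comp_apply, flip_apply, zero_apply, map_zero, zero_add,
      smulRight_apply] at h1
    rw [h2] at h1
    rw [← h1]
    abel
  rw [g.curvatureInChart_apply, ← key X Y, ← key Y X, hs X Y]
  simp only [map_sub, map_smul]
  rw [g.christoffel_symm hy Y X]
  abel

/-- If `∇_X grad f = -K f X` and the curvature is `K (g(X, Z) Y - g(Y, Z) X)`, then the derivative
of `K` vanishes. -/
theorem Metric.hasMFDerivAt_zero_of_covDeriv_grad (hE : 1 < Module.finrank ℝ E) {f : M → ℝ}
    (hf : ContMDiff I 𝓘(ℝ, ℝ) ∞ f) (hpos : ∀ x, 0 < f x) {K : M → ℝ}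
    (hN : ∀ (x : M) (X : E), g.covDeriv (g.grad f) x X = (-(K x * f x) • X : E))
    (hR : ∀ (x : M) (u v w : E), g.curvatureInChart x (extChartAt I x x) u v w =
      K x • (g.inChart x (extChartAt I x x) u w • v - g.inChart x (extChartAt I x x) v w • u))
    (x : M) : HasMFDerivAt I 𝓘(ℝ, ℝ) K x (0 : E →L[ℝ] ℝ) := by
  apply hasMFDerivAt_of_comp_extChartAt_symm
  set y := extChartAt I x x with hy₀
  have hy : y ∈ (extChartAt I x).target := mem_extChartAt_target x
  set F := f ∘ (extChartAt I x).symm with hFdef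
  set V := vectorFieldInChart (g.grad f) x with hVdef
  let c : E → ℝ := fun z => -(K ((extChartAt I x).symm z) * F z)
  have hF0 : ∀ z, F z ≠ 0 := fun z => (hpos _).ne'
  have hNc : ∀ᶠ z in 𝓝 y, ∀ X, g.covDerivInChart V x z X = c z • X := by
    filter_upwards [(isOpen_extChartAt_target x).mem_nhds hy] with z hz X
    exact g.covDerivInChart_of_covDeriv hz
      (fun x₁ z hz => (g.contDiffAt_grad hf hz).differentiableAt (by simp)) hN X
  have hVs : ContDiffAt ℝ ∞ V y := g.contDiffAt_grad hf hy
  have hFd := ((contDiffAt_comp_extChartAt_symm hf hy).differentiableAt (by simp)).hasFDerivAt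
  -- Differentiability of `K` is not assumed. It is inherited from `c`, which near `y` equals `ℓ` of
  -- the smooth field ∇_e grad f for a functional with `ℓ e = 1`.
  have hcd : DifferentiableAt ℝ c y := by
    have : Nontrivial E := Module.nontrivial_of_finrank_pos (R := ℝ) (by omega)
    obtain ⟨e, he⟩ := exists_ne (0 : E)
    obtain ⟨ℓ, hℓ⟩ := SeparatingDual.exists_eq_one (R := ℝ) he
    have h1 : DifferentiableAt ℝ (fun z => ℓ (g.covDerivInChart V x z e)) y := by
      have hV' := (hVs.fderiv_right (m := ∞) (by simp)).differentiableAt (by simp)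
      have hΓ := (g.contDiffAt_christoffel hy).differentiableAt (by simp)
      exact ℓ.differentiableAt.comp y ((hV'.clm_apply (differentiableAt_const e)).add
        ((hΓ.clm_apply (differentiableAt_const e)).clm_apply (hVs.differentiableAt (by simp))))
    refine h1.congr_of_eventuallyEq ?_
    filter_upwards [hNc] with z hz
    rw [hz, map_smul, hℓ, smul_eq_mul, mul_one]
  have hKc : K ∘ (extChartAt I x).symm = fun z => -(c z * (F z)⁻¹) := by
    funext z
    simp [c, hF0 z]
  have hKd : DifferentiableAt ℝ (K ∘ (extChartAt I x).symm) y := by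
    rw [hKc]
    exact (hcd.mul (hFd.differentiableAt.inv (hF0 y))).neg
  have hK := hKd.hasFDerivAt
  set D := fderiv ℝ (K ∘ (extChartAt I x).symm) y
  have hc := (hK.mul hFd).neg
  have hKy : (K ∘ (extChartAt I x).symm) y = K x := congrArg K (extChartAt_to_inv x)
  have hric := g.curvatureInChart_of_covDerivInChart hy hVs hc hNc
  have hz : D = 0 := by
    ext X
    by_cases hX : X = 0
    · simp [hX]
    -- With `Y` independent of `X`, the coefficient of `Y` isolates `F y * D X`; the terms
    -- containing dF cancel.
    obtain ⟨Y, hXY⟩ := exists_linearIndependent_pair_of_one_lt_finrank hE hX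
    have h1 := (hric X Y).symm.trans (hR x X Y (V y))
    rw [g.inChart_symm x y X, g.inChart_symm x y Y, g.inChart_grad hf hy, g.inChart_grad hf hy,
      hKy] at h1
    simp only [neg_apply, add_apply, smul_apply, smul_eq_mul] at h1
    have h2 : (-(F y * D Y)) • X + (F y * D X) • Y = 0 := by
      rw [← sub_eq_zero] at h1
      rw [← h1]
      module
    have h3 := (LinearIndependent.pair_iff.1 hXY _ _ h2).2
    simpa [hF0 y] using h3
  rwa [hz] at hK

end ConcircularGradient

/-! ### Splitting concircular flatness into its components -/

section StaticFlat

variable {E : Type*} [NormedAddCommGroup E] [NormedSpace ℝ E] [FiniteDimensional ℝ E]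
  {M : Type*} [TopologicalSpace M] [ChartedSpace E M] [IsManifold 𝓘(ℝ, E) ∞ M]
  (g : Metric 𝓘(ℝ, E) M) (J : TopologicalSpace.Opens ℝ) {f : M → ℝ}
  (hf : ContMDiff 𝓘(ℝ, E) 𝓘(ℝ, ℝ) ∞ f) (hpos : ∀ x, 0 < f x)

theorem Metric.concircular_eq_zero_iff {H : Type*} [TopologicalSpace H]
    {I : ModelWithCorners ℝ E H} [I.Boundaryless] {M : Type*} [TopologicalSpace M]
    [ChartedSpace H M] [IsManifold I ∞ M] (g : Metric I M) (x : M) (X Y Z : E) :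
    g.concircular x X Y Z = (0 : E) ↔ g.curvatureInChart x (extChartAt I x x) X Y Z =
      (g.scalarCurvature x / ((Module.finrank ℝ E : ℝ) * ((Module.finrank ℝ E : ℝ) - 1))) •
        (g.inChart x (extChartAt I x x) X Z • Y - g.inChart x (extChartAt I x x) Y Z • X) := by
  rw [g.inChart_self, g.inChart_self]
  exact sub_eq_zero

/-- The components of the equation of concircular flatness of a standard static space-time. -/
theorem staticMetric_concircularlyFlat_iff {n : ℕ} (hE : Module.finrank ℝ E = n) {k : J × M → ℝ}
    (hk : ∀ p, k p = (staticMetric J f hf hpos g).scalarCurvature p / ((n : ℝ) * ((n : ℝ) + 1))) :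
    (staticMetric J f hf hpos g).ConcircularlyFlat ↔ ∀ (t : J) (x : M),
      (∀ X : E, g.covDeriv (g.grad f) x X = (-(k (t, x) * f x) • X : E)) ∧
      ∀ u v w : E, g.curvatureInChart x (extChartAt 𝓘(ℝ, E) x x) u v w =
        k (t, x) • (g.inChart x (extChartAt 𝓘(ℝ, E) x x) u w • v
          - g.inChart x (extChartAt 𝓘(ℝ, E) x x) v w • u) := by
  have hflat : (staticMetric J f hf hpos g).ConcircularlyFlat ↔ ∀ (t : J) (x : M) (X Y Z : ℝ × E),
      (staticMetric J f hf hpos g).concircular (t, x) X Y Z = (0 : ℝ × E) :=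
    ⟨fun h t x => h (t, x), fun h p => h p.1 p.2⟩
  rw [hflat]
  refine forall_congr' fun t => forall_congr' fun x => ?_
  have hy := mem_extChartAt_target (I := 𝓘(ℝ, ℝ).prod 𝓘(ℝ, E)) (t, x)
  -- The space-time has dimension N = n + 1, so N(N - 1) = n(n + 1).
  have hkp : (staticMetric J f hf hpos g).scalarCurvature (t, x) /
      ((Module.finrank ℝ (ℝ × E) : ℝ) * ((Module.finrank ℝ (ℝ × E) : ℝ) - 1)) = k (t, x) := by
    rw [hk, Module.finrank_prod, Module.finrank_self, hE]
    push_cast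
    ring
  set y := extChartAt (𝓘(ℝ, ℝ).prod 𝓘(ℝ, E)) (t, x) (t, x) with hy₀
  have hy2 : y.2 = extChartAt 𝓘(ℝ, E) x x := by
    rw [hy₀, extChartAt_prod]
    rfl
  have hFx : (f ∘ (extChartAt 𝓘(ℝ, E) x).symm) y.2 = f x := by
    rw [hy2]
    exact congrArg f (extChartAt_to_inv (I := 𝓘(ℝ, E)) x)
  have hfx : f x ≠ 0 := (hpos x).ne'
  set N : E → E := g.covDerivInChart (vectorFieldInChart (g.grad f) x) x y.2
  have hcov : (∀ X : E, g.covDeriv (g.grad f) x X = (-(k (t, x) * f x) • X : E)) ↔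
      ∀ X, N X = -(k (t, x) * f x) • X := by
    refine forall_congr' fun X => ?_
    rw [g.covDeriv_eq, ← hy2]
    exact Iff.rfl
  have hcirc : ∀ X Y Z : ℝ × E,
      (staticMetric J f hf hpos g).concircular (t, x) X Y Z = (0 : ℝ × E) ↔
      (f x)⁻¹ * (X.1 * g.inChart x y.2 (N Y.2) Z.2
          - Y.1 * g.inChart x y.2 (N X.2) Z.2) =
        k (t, x) * ((-(f x ^ 2) * (X.1 * Z.1) + g.inChart x y.2 X.2 Z.2) * Y.1
          - (-(f x ^ 2) * (Y.1 * Z.1) + g.inChart x y.2 Y.2 Z.2) * X.1) ∧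
      g.curvatureInChart x y.2 X.2 Y.2 Z.2
          + (f x * Z.1) • (X.1 • (N Y.2)
            - Y.1 • (N X.2)) =
        k (t, x) • ((-(f x ^ 2) * (X.1 * Z.1) + g.inChart x y.2 X.2 Z.2) • Y.2
          - (-(f x ^ 2) * (Y.1 * Z.1) + g.inChart x y.2 Y.2 Z.2) • X.2) := by
    intro X Y Z
    rw [Metric.concircular_eq_zero_iff, hkp,
      staticMetric_curvatureInChart g J hf hpos hy rfl rfl, staticMetric_inChart g J hf hpos hy,
      staticMetric_inChart g J hf hpos hy, Prod.ext_iff, hFx]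
    rfl
  simp only [hcirc, hcov, ← hy2]
  constructor
  · intro h
    refine ⟨fun X => ?_, fun u v w => ?_⟩
    · have h1 := (h (1, 0) (0, X) (1, 0)).2
      simp only [map_zero, zero_apply, zero_add, mul_one, one_smul, zero_smul, sub_zero, mul_zero,
        add_zero, smul_zero] at h1
      have h2 := congrArg (fun a => (f x)⁻¹ • a) h1
      simp only [smul_smul, inv_mul_cancel₀ hfx, one_smul] at h2
      rw [h2]
      congr 1
      field_simp
    · have h1 := (h (0, u) (0, v) (0, w)).2
      simpa using h1
  · rintro ⟨hN, hR⟩ X Y Z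
    -- With both equations inserted, each component is an algebraic identity.
    simp only [hN, hR, map_smul, smul_apply, smul_eq_mul]
    constructor
    · field_simp
      ring
    · module

end StaticFlat

end PseudoRiemannian

/-! ### The characterization of concircular flatness -/

theorem mainTheorem10 {E : Type*} [NormedAddCommGroup E] [NormedSpace ℝ E]
    [FiniteDimensional ℝ E] (n : ℕ) (hn : 3 ≤ n) (hE : Module.finrank ℝ E = n)
    {M : Type*} [TopologicalSpace M] [ChartedSpace E M] [IsManifold 𝓘(ℝ, E) ∞ M]
    [ConnectedSpace M] (g : PseudoRiemannian.Metric 𝓘(ℝ, E) M)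
    (J : TopologicalSpace.Opens ℝ) (hJ : IsConnected (J : Set ℝ))
    (f : M → ℝ) (hf : ContMDiff 𝓘(ℝ, E) 𝓘(ℝ, ℝ) ∞ f) (hpos : ∀ x, 0 < f x) :
    (PseudoRiemannian.staticMetric J f hf hpos g).ConcircularlyFlat ↔
      (∀ (t : J) (x : M) (X : TangentSpace 𝓘(ℝ, E) x),
        g.covDeriv (g.grad f) x X =
          -((PseudoRiemannian.staticMetric J f hf hpos g).scalarCurvature (t, x) * f x
            / ((n : ℝ) * ((n : ℝ) + 1))) • X) ∧
      ∃ κ : ℝ,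
        (∀ p : J × M, κ = (PseudoRiemannian.staticMetric J f hf hpos g).scalarCurvature p
            / ((n : ℝ) * ((n : ℝ) + 1))) ∧
        g.HasConstantSectionalCurvature κ := by
  let k : J × M → ℝ := fun p =>
    (PseudoRiemannian.staticMetric J f hf hpos g).scalarCurvature p / ((n : ℝ) * ((n : ℝ) + 1))
  have hkf : ∀ t x, -((PseudoRiemannian.staticMetric J f hf hpos g).scalarCurvature (t, x) * f x
      / ((n : ℝ) * ((n : ℝ) + 1))) = -(k (t, x) * f x) := fun t x => by
    simp only [k]
    ring
  rw [PseudoRiemannian.staticMetric_concircularlyFlat_iff g J hf hpos hE (k := k) fun _ => rfl]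
  simp only [hkf]
  constructor
  · intro h
    refine ⟨fun t x => (h t x).1, ?_⟩
    obtain ⟨t₀, ht₀⟩ := hJ.nonempty
    obtain ⟨x₀⟩ : Nonempty M := inferInstance
    -- A single time slice is enough to obtain constancy along M.
    let K : M → ℝ := fun x => k (⟨t₀, ht₀⟩, x)
    have hK : IsLocallyConstant K := PseudoRiemannian.isLocallyConstant_of_hasMFDerivAt_zero
      fun x => g.hasMFDerivAt_zero_of_covDeriv_grad (by omega) hf hpos (fun x => (h _ x).1)
        (fun x => (h _ x).2) x
    have hKx : ∀ x, K x = K x₀ := fun x => hK.apply_eq_of_preconnectedSpace x x₀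
    refine ⟨K x₀, fun p => ?_, ?_⟩
    · have : Nontrivial E := Module.nontrivial_of_finrank_pos (R := ℝ) (by omega)
      obtain ⟨e, he⟩ := exists_ne (0 : E)
      -- Both times give the same ∇_e grad f with `e ≠ 0`. Since f > 0, the two values of k agree.
      have h1 : (-(k (p.1, p.2) * f p.2) • e : E) = -(K p.2 * f p.2) • e :=
        ((h p.1 p.2).1 e).symm.trans ((h _ p.2).1 e)
      have h2 := mul_right_cancel₀ (hpos p.2).ne' (neg_injective (smul_left_injective ℝ he h1))
      exact ((h2.trans (hKx p.2))).symm
    · rw [g.hasConstantSectionalCurvature_iff (by omega)]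
      intro x
      rw [← hKx x]
      exact (h _ x).2
  · rintro ⟨h1, κ, hκ, h2⟩ t x
    refine ⟨h1 t x, ?_⟩
    -- Constant sectional curvature returns the full curvature tensor, which is the second component
    -- equation.
    rw [g.hasConstantSectionalCurvature_iff (by omega)] at h2
    have hκp : k (t, x) = κ := (hκ (t, x)).symm
    rw [hκp]
    exact h2 x
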